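/- Notation. For a Borel set $E\subset\mathbb C$ let $\mathcal P(E)$ be the set of compactly supported Borel probability measures on $\mathbb C$ with support in $E$. For $\mu\in\mathcal P(\mathbb C)$ let $p_\mu(z)=-\int\log|z-w|\,d\mu(w)\in(-\infty,\infty]$ be its logarithmic potential, and, for an external field $Q:\mathbb C\to\mathbb R$, let $$R_\mu=\int p_\mu\,d\mu+2\int Q\,d\mu .$$ The minimum energy is $R_\emptyset=\inf\{R_\mu:\mu\in\mathcal P(\mathbb C)\}$. An equilibrium measure for $\mathbb C$ with external field $Q$ is a measure $\mu\in\mathcal P(\mathbb C)$ that minimizes $R_\mu$ over $\mathcal P(\mathbb C)$, where the weight $w=e^{-Q}$ is required to be admissible, i.e. $w$ is upper semicontinuous, $\{w>0\}$ has positive logarithmic capacity, and $|z|w(z)\to0$ as $|z|\to\infty$. Theorem. Let $g:[0,\infty)\to[0,\infty)$ satisfy: (1) $g$ is (weakly) increasing and $re^{-g(r)/2}\to0$ as $r\to\infty$; (2) $g$ is twice differentiable on $(0,\infty)$; (3) $\lim_{r\to0^+}rg'(r)=0$ and $rg'(r)$ is (weakly) increasing on $(0,\infty)$. Then there is $T>0$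 with $Tg'(T)=2$, and it is unique if $rg'(r)$ is strictly increasing. Moreover $g''(r)+\frac1r g'(r)\ge0$ for all $r>0$, and for every $T>0$ with $Tg'(T)=2$ the following hold. (a) There is exactly one equilibrium measure for $\mathbb C$ with external field $Q(z)=g(|z|)/2$, namely (with $r=|z|$ and $m$ the Lebesgue measure on $\mathbb C$) $$d\mu(z)=\begin{cases}\frac1{4\pi}\left[g''(r)+\frac1r g'(r)\right]dm(z)&\text{if }|z|\le T,\\0&\text{otherwise.}\end{cases}$$ (b) $r\mapsto r\,g'(r)^2$ is integrable on $(0,T)$, and the minimum energy is $$R_\emptyset^{(g)}=\log\frac1T+g(T)-\frac14\int_0^Tr\,(g'(r))^2\,dr .$$ In particular, for every $\alpha>0$ the function $g(r)=r^\alpha$ satisfies (1)–(3), the solution of $Tg'(T)=2$ is $T=(2/\alpha)^{1/\alpha}$, the unique equilibrium measure for $\mathbb C$ with external field $|z|^\alpha/2$ is $\frac{\alpha^2}{4\pi}|z|^{\alpha-2}\,dm(z)$ on $|z|\le(2/\alpha)^{1/\alpha}$ and $0$ elsewhere, and the minimum energy is $$R_\emptyset^{(\alpha)}=\frac34\cdot\frac2\alpha-\frac1\alpha\log\frac2\alpha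 .$$ -/

import Mathlib

open MeasureTheory Set Filter Topology
open scoped ENNReal

namespace LogPotential

noncomputable section

/-- The integral `∫ f dμ ∈ [-∞, ∞]` of an extended real function, as the integral of the positive
part minus the integral of the negative part. It is meaningful when at least one of the two is
finite; this is so in every use below, because the integrands are bounded below on the (compact)
supports of the measures considered. -/
def extIntegral (μ : Measure ℂ) (f : ℂ → EReal) : EReal :=
  ((∫⁻ z, (f z).toENNReal ∂μ : ℝ≥0∞) : EReal) - ((∫⁻ z, (-f z).toENNReal ∂μ : ℝ≥0∞) : EReal)

/-- The logarithmic kernel `-log |z - w| ∈ (-∞, ∞]`, equal to `+∞` on the diagonal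
(`ENNReal.log 0 = ⊥`). -/
def logKernel (z w : ℂ) : EReal := -ENNReal.log (edist z w)

/-- The logarithmic potential `p_μ(z) = -∫ log |z - w| dμ(w)`. -/
def potential (μ : Measure ℂ) (z : ℂ) : EReal := extIntegral μ (logKernel z)

/-- The logarithmic energy `I_μ = ∫ p_μ dμ`. -/
def logEnergy (μ : Measure ℂ) : EReal := extIntegral μ (potential μ)

/-- `𝒫(E)`: the compactly supported Borel probability measures on `ℂ` with support in `E`. -/
def compactProb (E : Set ℂ) : Set (Measure ℂ) :=
  {μ | IsProbabilityMeasure μ ∧ IsCompact μ.support ∧ μ.support ⊆ E}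

/-- The logarithmic capacity `C(E) = exp (-inf {I_μ : μ ∈ 𝒫(E)})`. -/
def capacity (E : Set ℂ) : ℝ≥0∞ := EReal.exp (-(⨅ μ ∈ compactProb E, logEnergy μ))

/-- Admissible weight functions `w : E → [0, ∞)` on a closed set `E`. When `E` is bounded the last
condition is void, since the filter is then trivial. -/
structure IsAdmissible (E : Set ℂ) (w : ℂ → ℝ) : Prop where
  isClosed : IsClosed E
  nonneg : ∀ z ∈ E, 0 ≤ w z
  upperSemicontinuousOn : UpperSemicontinuousOn w E
  capacity_pos : 0 < capacity {z | z ∈ E ∧ 0 < w z}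
  decay : Tendsto (fun z => ‖z‖ * w z) (Bornology.cobounded ℂ ⊓ 𝓟 E) (𝓝 0)

/-- The weighted energy `R_μ = ∫ p_μ dμ + 2 ∫ Q dμ`. -/
def weightedEnergy (Q : ℂ → ℝ) (μ : Measure ℂ) : EReal :=
  logEnergy μ + 2 * extIntegral μ (fun z => (Q z : EReal))

/-- The minimum energy `R_U = inf {R_μ : μ ∈ 𝒫(Uᶜ)}` with external field `Q`. -/
def minEnergy (Q : ℂ → ℝ) (U : Set ℂ) : EReal :=
  ⨅ μ ∈ compactProb Uᶜ, weightedEnergy Q μ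

/-- `μ` is a (weighted) equilibrium measure for `E` with external field `Q`: the weight `e^{-Q}` is
admissible on `E`, and `μ` minimizes the weighted energy over `𝒫(E)`. -/
structure IsEquilibriumMeasure (E : Set ℂ) (Q : ℂ → ℝ) (μ : Measure ℂ) : Prop where
  admissible : IsAdmissible E (fun z => Real.exp (-Q z))
  mem : μ ∈ compactProb E
  minimizes : ∀ ν ∈ compactProb E, weightedEnergy Q μ ≤ weightedEnergy Q ν

/-- The standing assumptions on the radial profile `g : [0, ∞) → [0, ∞)`. Only the values of `g`
on `[0, ∞)` are constrained. -/
structure IsRadialProfile (g : ℝ → ℝ) : Prop where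
  nonneg : ∀ r, 0 ≤ r → 0 ≤ g r
  monotoneOn : MonotoneOn g (Ici 0)
  decay : Tendsto (fun r : ℝ => r * Real.exp (-(g r / 2))) atTop (𝓝 0)
  differentiableAt : ∀ r, 0 < r → DifferentiableAt ℝ g r
  differentiableAt_deriv : ∀ r, 0 < r → DifferentiableAt ℝ (deriv g) r
  tendsto_zero : Tendsto (fun r : ℝ => r * deriv g r) (𝓝[>] 0) (𝓝 0)
  monotoneOn_mul_deriv : MonotoneOn (fun r : ℝ => r * deriv g r) (Ioi 0)

/-- The external field `Q(z) = g(|z|) / 2`. -/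
def radialField (g : ℝ → ℝ) (z : ℂ) : ℝ := g ‖z‖ / 2

/-- The measure `ρ(|z|) dm(z)` on the disk `|z| ≤ T` (and `0` outside), where `m` is Lebesgue
measure on `ℂ`, for a density `ρ` which is nonnegative on `(0, T]`. -/
def radialMeasure (ρ : ℝ → ℝ) (T : ℝ) : Measure ℂ :=
  (volume.restrict {z : ℂ | ‖z‖ ≤ T}).withDensity (fun z => ENNReal.ofReal (ρ ‖z‖))

/-- The density `(1 / 4π) (g''(r) + g'(r) / r)`. -/
def eqDensity (g : ℝ → ℝ) (r : ℝ) : ℝ :=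
  1 / (4 * Real.pi) * (deriv (deriv g) r + 1 / r * deriv g r)

end

end LogPotential

namespace LogPotential

noncomputable section

/-! The proof combines a Frostman-type variational inequality with strict positivity of the
logarithmic energy. Write `μ` for the candidate measure on the disk.

The disk of radius `r ≤ T` has `μ`-mass `r g'(r) / 2`, so `T g'(T) = 2` says that the total mass is
one. The mean of `-log |z - ·|` over a circle of radius `r` is `-log max(|z|, r)`, and integrating
over circles gives `p_μ(z) = -log T + (g(T) - g(|z|)) / 2` for `0 < |z| ≤ T` and `p_μ(z) = -log |z|`
for `|z| ≥ T`. Hence `2 p_μ + g` is constant on the punctured disk, and outside it is `g(r) - 2 log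
r`, which increases because `r g' ≥ 2` there (`two_mul_lintegral_shiftedKernel_add_of_le`,
`le_two_mul_lintegral_shiftedKernel_add`).

Integrating against a competitor `ν` bounds the mixed energy of `ν` and `μ` from below. It is
bounded from above by `2 I(ν, μ) ≤ I(ν, ν) + I(μ, μ)` (`two_mul_shiftedEnergy_le`), and the two
together give minimality. Uniqueness is the equality case, `eq_of_shiftedEnergy_le`. Both rest on
Frullani's integral, which writes `log D - log |z - w|` as a positive superposition of Gaussians in
`|z - w|`, up to constants. Each Gaussian energy is an L² inner product of Gaussian transforms, and
a finite measure is determined by its Gaussian transform at a single scale.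

Energies are computed in `ℝ≥0∞` with the kernel shifted by `log D`, where `D` bounds the distances
involved. The kernel is then nonnegative, so Tonelli applies freely and no signed measure appears.
-/

/-! ### Positive definiteness of the Gaussian kernel. -/

/-- The Gaussian transform `u ↦ ∫ exp (-2t |z - u|²) dν(z)` of a measure. -/
def gaussTransform (ν : Measure ℂ) (t : ℝ) (u : ℂ) : ℝ≥0∞ :=
  ∫⁻ z, ENNReal.ofReal (Real.exp (-(2 * t) * ‖z - u‖ ^ 2)) ∂ν

/-- The mutual energy of two measures for the Gaussian kernel `exp (-t |z - w|²)`. -/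
def gaussEnergy (ν ν' : Measure ℂ) (t : ℝ) : ℝ≥0∞ :=
  ∫⁻ z, ∫⁻ w, ENNReal.ofReal (Real.exp (-t * ‖z - w‖ ^ 2)) ∂ν' ∂ν

/-- The total mass of the Gaussian `exp (-4t |u|²)`. -/
def gaussMass (t : ℝ) : ℝ≥0∞ := ∫⁻ u : ℂ, ENNReal.ofReal (Real.exp (-(4 * t) * ‖u‖ ^ 2))

lemma gaussMass_ne_top {t : ℝ} (ht : 0 < t) : gaussMass t ≠ ⊤ := by
  have h : Integrable (fun u : ℂ => Real.exp (-(4 * t) * ‖u‖ ^ 2)) := by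
    have := GaussianFourier.integrable_cexp_neg_mul_sq_norm_add (V := ℂ) (b := (4 * t : ℝ))
      (by simpa using ht) 0 0
    refine this.norm.congr (ae_of_all _ fun u => ?_)
    dsimp only
    rw [Complex.norm_exp]
    simp [← Complex.ofReal_pow, -Complex.ofReal_mul, ← Complex.ofReal_neg]
  exact h.lintegral_lt_top.ne

lemma gaussMass_ne_zero (t : ℝ) : gaussMass t ≠ 0 := by
  intro h
  rw [gaussMass, lintegral_eq_zero_iff (by fun_prop)] at h
  obtain ⟨u, hu⟩ := h.exists
  exact (Real.exp_pos _).not_ge (ENNReal.ofReal_eq_zero.1 hu)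

/-- By the parallelogram law `|z - u|² + |w - u|² = 2 |u - (z + w)/2|² + |z - w|² / 2`, so the
Gaussian kernel is a convolution square up to a constant. -/
lemma lintegral_gauss_mul_gauss (t : ℝ) (z w : ℂ) :
    ∫⁻ u : ℂ, ENNReal.ofReal (Real.exp (-(2 * t) * ‖z - u‖ ^ 2)) *
      ENNReal.ofReal (Real.exp (-(2 * t) * ‖w - u‖ ^ 2)) =
      gaussMass t * ENNReal.ofReal (Real.exp (-t * ‖z - w‖ ^ 2)) := by
  have key (u : ℂ) : ENNReal.ofReal (Real.exp (-(2 * t) * ‖z - u‖ ^ 2)) *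
      ENNReal.ofReal (Real.exp (-(2 * t) * ‖w - u‖ ^ 2)) =
      ENNReal.ofReal (Real.exp (-(4 * t) * ‖u - (z + w) / 2‖ ^ 2)) *
        ENNReal.ofReal (Real.exp (-t * ‖z - w‖ ^ 2)) := by
    rw [← ENNReal.ofReal_mul (Real.exp_pos _).le, ← ENNReal.ofReal_mul (Real.exp_pos _).le,
      ← Real.exp_add, ← Real.exp_add]
    congr 2
    simp only [Complex.sq_norm, Complex.normSq_apply, Complex.sub_re, Complex.sub_im,
      Complex.div_ofNat_re, Complex.div_ofNat_im, Complex.add_re, Complex.add_im]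
    ring
  simp_rw [key]
  rw [lintegral_mul_const _ (by fun_prop), gaussMass]
  congr 1
  exact lintegral_sub_right_eq_self
    (fun u : ℂ => ENNReal.ofReal (Real.exp (-(4 * t) * ‖u‖ ^ 2))) _

lemma measurable_gaussTransform (ν : Measure ℂ) [SFinite ν] (t : ℝ) :
    Measurable (gaussTransform ν t) := by
  unfold gaussTransform
  exact Measurable.lintegral_prod_right' (f := fun p : ℂ × ℂ =>
    ENNReal.ofReal (Real.exp (-(2 * t) * ‖p.2 - p.1‖ ^ 2))) (by fun_prop)

/-- Tonelli turns the convolution square into an L² inner product of transforms. -/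
lemma lintegral_gaussTransform_mul (ν ν' : Measure ℂ) [SFinite ν] [SFinite ν'] (t : ℝ) :
    ∫⁻ u, gaussTransform ν t u * gaussTransform ν' t u = gaussMass t * gaussEnergy ν ν' t := by
  calc ∫⁻ u, gaussTransform ν t u * gaussTransform ν' t u
      = ∫⁻ u, ∫⁻ z, ∫⁻ w, ENNReal.ofReal (Real.exp (-(2 * t) * ‖z - u‖ ^ 2)) *
          ENNReal.ofReal (Real.exp (-(2 * t) * ‖w - u‖ ^ 2)) ∂ν' ∂ν := by
        refine lintegral_congr fun u => ?_
        rw [gaussTransform, gaussTransform, ← lintegral_mul_const _ (by fun_prop)]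
        refine lintegral_congr fun z => ?_
        rw [lintegral_const_mul _ (by fun_prop)]
    _ = ∫⁻ z, ∫⁻ u, ∫⁻ w, ENNReal.ofReal (Real.exp (-(2 * t) * ‖z - u‖ ^ 2)) *
          ENNReal.ofReal (Real.exp (-(2 * t) * ‖w - u‖ ^ 2)) ∂ν' ∂volume ∂ν := by
        rw [lintegral_lintegral_swap]
        refine Measurable.aemeasurable ?_
        exact Measurable.lintegral_prod_right' (f := fun p : (ℂ × ℂ) × ℂ =>
          ENNReal.ofReal (Real.exp (-(2 * t) * ‖p.1.2 - p.1.1‖ ^ 2)) *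
          ENNReal.ofReal (Real.exp (-(2 * t) * ‖p.2 - p.1.1‖ ^ 2))) (by fun_prop)
    _ = ∫⁻ z, ∫⁻ w, gaussMass t * ENNReal.ofReal (Real.exp (-t * ‖z - w‖ ^ 2)) ∂ν' ∂ν := by
        refine lintegral_congr fun z => ?_
        rw [lintegral_lintegral_swap (by fun_prop)]
        exact lintegral_congr fun w => lintegral_gauss_mul_gauss t z w
    _ = gaussMass t * gaussEnergy ν ν' t := by
        rw [gaussEnergy, ← lintegral_const_mul]
        · exact lintegral_congr fun z => lintegral_const_mul _ (by fun_prop)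
        · exact Measurable.lintegral_prod_right' (f := fun p : ℂ × ℂ =>
            ENNReal.ofReal (Real.exp (-t * ‖p.1 - p.2‖ ^ 2))) (by fun_prop)

lemma two_mul_mul_le_add_mul_self (a b : ℝ≥0∞) : 2 * (a * b) ≤ a * a + b * b := by
  rcases eq_or_ne a ⊤ with rfl | ha
  · simp
  rcases eq_or_ne b ⊤ with rfl | hb
  · simp
  lift a to NNReal using ha
  lift b to NNReal using hb
  norm_cast
  simpa [sq, mul_assoc] using two_mul_le_add_sq a b

lemma eq_of_two_mul_mul_eq_add_mul_self {a b : ℝ≥0∞} (ha : a ≠ ⊤) (hb : b ≠ ⊤)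
    (h : 2 * (a * b) = a * a + b * b) : a = b := by
  lift a to NNReal using ha
  lift b to NNReal using hb
  norm_cast at h ⊢
  have h' : (2 * (a * b) : ℝ) = a * a + b * b := by exact_mod_cast h
  have : ((a : ℝ) - b) ^ 2 = 0 := by linarith
  exact NNReal.eq (sub_eq_zero.1 (pow_eq_zero_iff two_ne_zero |>.1 this))

/-- This is `‖f - h‖² ≥ 0` in L² for the two transforms, expanded so that no subtraction occurs in
`ℝ≥0∞`. -/
lemma two_mul_gaussEnergy_le {t : ℝ} (ht : 0 < t) (ν μ : Measure ℂ) [SFinite ν] [SFinite μ] :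
    2 * gaussEnergy ν μ t ≤ gaussEnergy ν ν t + gaussEnergy μ μ t := by
  refine (ENNReal.mul_le_mul_iff_right (gaussMass_ne_zero t) (gaussMass_ne_top ht)).1 ?_
  rw [mul_left_comm, mul_add, ← lintegral_gaussTransform_mul, ← lintegral_gaussTransform_mul,
    ← lintegral_gaussTransform_mul, ← lintegral_const_mul, ← lintegral_add_left]
  · exact lintegral_mono fun u => two_mul_mul_le_add_mul_self _ _
  · exact (measurable_gaussTransform ν t).mul (measurable_gaussTransform ν t)
  · exact (measurable_gaussTransform ν t).mul (measurable_gaussTransform μ t)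

lemma gaussEnergy_ne_top {t : ℝ} (ht : 0 ≤ t) (ν μ : Measure ℂ) [IsFiniteMeasure ν]
    [IsFiniteMeasure μ] : gaussEnergy ν μ t ≠ ⊤ := by
  refine ne_top_of_le_ne_top (b := ∫⁻ _, ∫⁻ _, 1 ∂μ ∂ν) (by simp [ENNReal.mul_eq_top]) ?_
  refine lintegral_mono fun z => lintegral_mono fun w => ?_
  rw [← ENNReal.ofReal_one]
  refine ENNReal.ofReal_le_ofReal (Real.exp_le_one_iff.2 ?_)
  rw [neg_mul]
  exact neg_nonpos.2 (by positivity)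

lemma gaussTransform_eq_ofReal {t : ℝ} (ht : 0 ≤ t) (ν : Measure ℂ) [IsFiniteMeasure ν] (u : ℂ) :
    gaussTransform ν t u = ENNReal.ofReal (∫ z, Real.exp (-(2 * t) * ‖z - u‖ ^ 2) ∂ν) := by
  rw [gaussTransform, ofReal_integral_eq_lintegral_ofReal]
  · refine Integrable.of_bound (by fun_prop) 1 (ae_of_all _ fun z => ?_)
    rw [Real.norm_eq_abs, abs_of_pos (Real.exp_pos _), Real.exp_le_one_iff, neg_mul]
    exact neg_nonpos.2 (by positivity)
  · exact ae_of_all _ fun z => (Real.exp_pos _).le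

lemma continuous_gaussTransform {t : ℝ} (ht : 0 ≤ t) (ν : Measure ℂ) [IsFiniteMeasure ν] :
    Continuous (gaussTransform ν t) := by
  rw [show gaussTransform ν t = _ from funext (gaussTransform_eq_ofReal ht ν)]
  refine ENNReal.continuous_ofReal.comp (continuous_of_dominated (bound := fun _ => 1)
    (fun u => by fun_prop) (fun u => ae_of_all _ fun z => ?_) (integrable_const _)
    (ae_of_all _ fun z => by fun_prop))
  rw [Real.norm_eq_abs, abs_of_pos (Real.exp_pos _), Real.exp_le_one_iff, neg_mul]
  exact neg_nonpos.2 (by positivity)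

/-- Equality of the integrals forces equality a.e. in the pointwise bound `2ab ≤ a² + b²`;
continuity of the transforms removes the exceptional null set. -/
lemma gaussTransform_eq_of_gaussEnergy {t : ℝ} (ht : 0 < t) (ν μ : Measure ℂ) [IsFiniteMeasure ν]
    [IsFiniteMeasure μ] (h : 2 * gaussEnergy ν μ t = gaussEnergy ν ν t + gaussEnergy μ μ t) :
    gaussTransform ν t = gaussTransform μ t := by
  have hν := measurable_gaussTransform ν t
  have hμ := measurable_gaussTransform μ t
  have hνμ : Measurable fun u => gaussTransform ν t u * gaussTransform μ t u := hν.mul hμ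
  have hνν : Measurable fun u => gaussTransform ν t u * gaussTransform ν t u := hν.mul hν
  have h2 : ∫⁻ u, 2 * (gaussTransform ν t u * gaussTransform μ t u) =
      ∫⁻ u, (gaussTransform ν t u * gaussTransform ν t u +
        gaussTransform μ t u * gaussTransform μ t u) := by
    rw [lintegral_const_mul _ hνμ, lintegral_add_left hνν,
      lintegral_gaussTransform_mul, lintegral_gaussTransform_mul, lintegral_gaussTransform_mul,
      ← mul_add, ← h, mul_left_comm]
  have hae := ae_eq_of_ae_le_of_lintegral_le
    (ae_of_all _ fun u => two_mul_mul_le_add_mul_self (gaussTransform ν t u) (gaussTransform μ t u))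
    (by
      rw [lintegral_const_mul _ hνμ, lintegral_gaussTransform_mul]
      exact ENNReal.mul_ne_top (by simp)
        (ENNReal.mul_ne_top (gaussMass_ne_top ht) (gaussEnergy_ne_top ht.le ν μ)))
    ((hν.mul hν).add (hμ.mul hμ)).aemeasurable h2.ge
  refine Continuous.ae_eq_iff_eq volume (continuous_gaussTransform ht.le ν)
    (continuous_gaussTransform ht.le μ) |>.1 ?_
  filter_upwards [hae] with u hu
  refine eq_of_two_mul_mul_eq_add_mul_self ?_ ?_ hu
  · simp [gaussTransform_eq_ofReal ht.le]
  · simp [gaussTransform_eq_ofReal ht.le]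

/-! ### Injectivity of the Gaussian transform. -/

/-- The measure `ν` tilted by the Gaussian density `exp (-2t |z|²)`. -/
def gaussTilt (ν : Measure ℂ) (t : ℝ) : Measure ℂ :=
  ν.withDensity fun z => ENNReal.ofReal (Real.exp (-(2 * t) * ‖z‖ ^ 2))

instance isFiniteMeasure_gaussTilt (ν : Measure ℂ) [IsFiniteMeasure ν] (t : ℝ) [Fact (0 < t)] :
    IsFiniteMeasure (gaussTilt ν t) := by
  refine isFiniteMeasure_withDensity (ne_top_of_le_ne_top (b := ∫⁻ _, 1 ∂ν) (by simp) ?_)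
  refine lintegral_mono fun z => ?_
  rw [← ENNReal.ofReal_one]
  refine ENNReal.ofReal_le_ofReal (Real.exp_le_one_iff.2 ?_)
  have : 0 < t := Fact.out
  rw [neg_mul]
  exact neg_nonpos.2 (by positivity)

/-- Completing the square: an exponential of a linear form times a centred Gaussian is a translated
Gaussian. Thus the Gaussian transform encodes the moment generating functions of the tilted measure
in all directions. -/
lemma exists_gauss_mul_exp_eq (L : StrongDual ℝ ℂ) {t : ℝ} (ht : 0 < t) (s : ℝ) :
    ∃ u : ℂ, ∀ z : ℂ, Real.exp (-(2 * t) * ‖z‖ ^ 2) * Real.exp (s * L z) =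
      Real.exp (2 * t * ‖u‖ ^ 2) * Real.exp (-(2 * t) * ‖z - u‖ ^ 2) := by
  refine ⟨(s / (4 * t)) • (InnerProductSpace.toDual ℝ ℂ).symm L, fun z => ?_⟩
  have hL : L z = inner ℝ z ((InnerProductSpace.toDual ℝ ℂ).symm L) := by
    rw [real_inner_comm, InnerProductSpace.toDual_symm_apply]
  rw [← Real.exp_add, ← Real.exp_add, norm_sub_sq_real, inner_smul_right, ← hL]
  congr 1
  field_simp
  ring

lemma integrable_exp_gaussTilt (ν : Measure ℂ) [IsFiniteMeasure ν] {t : ℝ} (ht : 0 < t)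
    (L : StrongDual ℝ ℂ) (s : ℝ) : Integrable (fun z => Real.exp (s * L z)) (gaussTilt ν t) := by
  obtain ⟨u, hu⟩ := exists_gauss_mul_exp_eq L ht s
  rw [gaussTilt, integrable_withDensity_iff_integrable_smul' (by fun_prop) (by simp)]
  simp_rw [ENNReal.toReal_ofReal (Real.exp_pos _).le, smul_eq_mul, hu]
  refine Integrable.const_mul (Integrable.of_bound (by fun_prop) 1 (ae_of_all _ fun z => ?_)) _
  rw [Real.norm_eq_abs, abs_of_pos (Real.exp_pos _), Real.exp_le_one_iff, neg_mul]
  exact neg_nonpos.2 (by positivity)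

lemma mgf_gaussTilt (ν : Measure ℂ) [IsFiniteMeasure ν] {t : ℝ} (ht : 0 < t) {s : ℝ}
    {L : StrongDual ℝ ℂ} {u : ℂ} (hu : ∀ z : ℂ, Real.exp (-(2 * t) * ‖z‖ ^ 2) * Real.exp (s * L z) =
      Real.exp (2 * t * ‖u‖ ^ 2) * Real.exp (-(2 * t) * ‖z - u‖ ^ 2)) :
    ProbabilityTheory.mgf L (gaussTilt ν t) s =
      Real.exp (2 * t * ‖u‖ ^ 2) * (gaussTransform ν t u).toReal := by
  rw [gaussTransform_eq_ofReal ht.le,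
    ENNReal.toReal_ofReal (integral_nonneg fun z => (Real.exp_pos _).le),
    ProbabilityTheory.mgf, gaussTilt,
    integral_withDensity_eq_integral_toReal_smul (by fun_prop) (by simp), ← integral_const_mul]
  refine integral_congr_ae (ae_of_all _ fun z => ?_)
  simp only [ENNReal.toReal_ofReal (Real.exp_pos _).le, smul_eq_mul, hu]

/-- A finite measure on `ℂ` is determined by its Gaussian transform. -/
lemma eq_of_gaussTransform_eq {t : ℝ} (ht : 0 < t) {ν μ : Measure ℂ} [IsFiniteMeasure ν]
    [IsFiniteMeasure μ] (h : gaussTransform ν t = gaussTransform μ t) : ν = μ := by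
  have : Fact (0 < t) := ⟨ht⟩
  have hmgf (L : StrongDual ℝ ℂ) :
      ProbabilityTheory.mgf L (gaussTilt ν t) = ProbabilityTheory.mgf L (gaussTilt μ t) := by
    funext s
    obtain ⟨u, hu⟩ := exists_gauss_mul_exp_eq L ht s
    rw [mgf_gaussTilt ν ht hu, mgf_gaussTilt μ ht hu, h]
  have hzero : gaussTilt ν t = 0 ↔ gaussTilt μ t = 0 := by
    have := congrFun (hmgf 0) 0
    rw [ProbabilityTheory.mgf_zero', ProbabilityTheory.mgf_zero'] at this
    rw [← Measure.measure_univ_eq_zero, ← Measure.measure_univ_eq_zero, ← measureReal_eq_zero_iff,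
      ← measureReal_eq_zero_iff, this]
  have htilt : gaussTilt ν t = gaussTilt μ t := by
    refine Measure.ext_of_charFunDual (funext fun L => ?_)
    have hset : ProbabilityTheory.integrableExpSet L (gaussTilt ν t) = univ :=
      eq_univ_of_forall fun s => integrable_exp_gaussTilt ν ht L s
    -- The real moment generating functions are finite everywhere, so they continue analytically to
    -- `I`, where the continuation is the characteristic function.
    have := ProbabilityTheory.eqOn_complexMGF_of_mgf' (hmgf L) hzero (x := Complex.I)
      (by simp [hset])
    simpa [ProbabilityTheory.complexMGF, charFunDual_apply, mul_comm] using this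
  have hinv (κ : Measure ℂ) : (gaussTilt κ t).withDensity
      (fun z => (ENNReal.ofReal (Real.exp (-(2 * t) * ‖z‖ ^ 2)))⁻¹) = κ :=
    withDensity_inv_same (by fun_prop)
      (ae_of_all _ fun z => (ENNReal.ofReal_pos.2 (Real.exp_pos _)).ne')
      (ae_of_all _ fun z => ENNReal.ofReal_ne_top)
  rw [← hinv ν, htilt, hinv μ]

/-! ### Frullani's integral. -/

lemma lintegral_Ioi_exp_neg_mul {s : ℝ} (hs : 0 < s) :
    ∫⁻ t in Ioi (0 : ℝ), ENNReal.ofReal (Real.exp (-(t * s))) = ENNReal.ofReal s⁻¹ := by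
  have hi : IntegrableOn (fun t : ℝ => Real.exp (-s * t)) (Ioi 0) := integrableOn_exp_mul_Ioi
    (neg_neg_of_pos hs) 0
  have := integral_exp_mul_Ioi (neg_neg_of_pos hs) 0
  rw [← ofReal_integral_eq_lintegral_ofReal (by simpa [IntegrableOn, mul_comm] using hi)
    (ae_of_all _ fun t => (Real.exp_pos _).le)]
  congr 1
  simpa [mul_comm, neg_div_neg_eq] using this

lemma lintegral_Ioc_exp_neg_mul {a b t : ℝ} (hab : a ≤ b) (ht : 0 < t) :
    ∫⁻ s in Ioc a b, ENNReal.ofReal (Real.exp (-(t * s))) =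
      ENNReal.ofReal (t⁻¹ * (Real.exp (-(t * a)) - Real.exp (-(t * b)))) := by
  have hi : IntegrableOn (fun s : ℝ => Real.exp (-(t * s))) (Ioc a b) :=
    (by fun_prop : Continuous fun s : ℝ => Real.exp (-(t * s))).integrableOn_Ioc
  rw [← ofReal_integral_eq_lintegral_ofReal hi (ae_of_all _ fun t => (Real.exp_pos _).le),
    ← intervalIntegral.integral_of_le hab]
  congr 1
  have hd (x : ℝ) (_ : x ∈ uIcc a b) :
      HasDerivAt (fun s : ℝ => -(t⁻¹ * Real.exp (-(t * s)))) (Real.exp (-(t * x))) x := by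
    have := ((((hasDerivAt_id' x).const_mul t).fun_neg.exp).const_mul t⁻¹).fun_neg
    rw [mul_one] at this
    convert! this using 1
    field_simp
  rw [intervalIntegral.integral_eq_sub_of_hasDerivAt hd
    ((by fun_prop : Continuous fun s : ℝ => Real.exp (-(t * s))).intervalIntegrable _ _)]
  ring

/-- Frullani's integral for the exponential function, in integrated form. -/
lemma lintegral_frullani {a b : ℝ} (ha : 0 ≤ a) (hab : a ≤ b) :
    ∫⁻ t in Ioi (0 : ℝ), ENNReal.ofReal (t⁻¹ * (Real.exp (-(t * a)) - Real.exp (-(t * b)))) =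
      ∫⁻ s in Ioc a b, ENNReal.ofReal s⁻¹ := by
  calc _ = ∫⁻ t in Ioi (0 : ℝ), ∫⁻ s in Ioc a b, ENNReal.ofReal (Real.exp (-(t * s))) :=
        setLIntegral_congr_fun measurableSet_Ioi fun t ht => (lintegral_Ioc_exp_neg_mul hab ht).symm
    _ = ∫⁻ s in Ioc a b, ∫⁻ t in Ioi (0 : ℝ), ENNReal.ofReal (Real.exp (-(t * s))) :=
        lintegral_lintegral_swap (by fun_prop)
    _ = _ := setLIntegral_congr_fun measurableSet_Ioc fun s hs =>
        lintegral_Ioi_exp_neg_mul (ha.trans_lt hs.1)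

lemma lintegral_Ioc_inv {a b : ℝ} (ha : 0 < a) (hab : a ≤ b) :
    ∫⁻ s in Ioc a b, ENNReal.ofReal s⁻¹ = ENNReal.ofReal (Real.log b - Real.log a) := by
  have h0 : (0 : ℝ) ∉ uIcc a b := fun h => by
    rw [uIcc_of_le hab] at h
    exact ha.not_ge h.1
  have hi := intervalIntegral.intervalIntegrable_inv (μ := volume) (f := fun s : ℝ => s)
    (fun x hx h => h0 (h ▸ hx)) continuousOn_id
  rw [← ofReal_integral_eq_lintegral_ofReal
    ((intervalIntegrable_iff_integrableOn_Ioc_of_le hab).1 hi)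
    ((ae_restrict_mem measurableSet_Ioc).mono fun s hs => (inv_pos.2 (ha.trans hs.1)).le),
    ← intervalIntegral.integral_of_le hab, integral_inv h0,
    Real.log_div (ha.trans_le hab).ne' ha.ne']

lemma lintegral_Ioc_zero_inv {b : ℝ} (hb : 0 < b) :
    ∫⁻ s in Ioc 0 b, ENNReal.ofReal s⁻¹ = ⊤ := by
  by_contra h
  have hi : IntegrableOn (fun s : ℝ => s⁻¹) (Ioc 0 b) := by
    refine ⟨by fun_prop, ?_⟩
    rw [hasFiniteIntegral_iff_ofReal
      ((ae_restrict_mem measurableSet_Ioc).mono fun s hs => (inv_pos.2 hs.1).le)]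
    exact lt_top_iff_ne_top.2 h
  have := (intervalIntegrable_iff_integrableOn_Ioc_of_le hb.le).2 hi
  simp [hb.ne] at this

/-! ### The logarithmic kernel as a superposition of Gaussians, and its positivity. -/

/-- The logarithmic kernel shifted by `L` and cut off at `0`. -/
def shiftedKernel (L : ℝ) (z w : ℂ) : ℝ≥0∞ := (logKernel z w + L).toENNReal

/-- The mutual logarithmic energy of two measures for the shifted kernel. -/
def shiftedEnergy (L : ℝ) (ν ν' : Measure ℂ) : ℝ≥0∞ := ∫⁻ z, ∫⁻ w, shiftedKernel L z w ∂ν' ∂ν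

lemma logKernel_of_ne {z w : ℂ} (h : z ≠ w) : logKernel z w = ((-Real.log ‖z - w‖ : ℝ) : EReal) := by
  rw [logKernel, edist_dist, dist_eq_norm, ENNReal.log_ofReal_of_pos (norm_sub_pos_iff.2 h)]
  simp

lemma logKernel_self (z : ℂ) : logKernel z z = ⊤ := by simp [logKernel]

lemma shiftedKernel_of_ne (L : ℝ) {z w : ℂ} (h : z ≠ w) :
    shiftedKernel L z w = ENNReal.ofReal (L - Real.log ‖z - w‖) := by
  rw [shiftedKernel, logKernel_of_ne h, ← EReal.coe_add, EReal.real_coe_toENNReal]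
  congr 1
  ring

lemma shiftedKernel_self (L : ℝ) (z : ℂ) : shiftedKernel L z z = ⊤ := by
  simp [shiftedKernel, logKernel_self]

@[fun_prop]
lemma measurable_logKernel : Measurable fun p : ℂ × ℂ => logKernel p.1 p.2 := by
  unfold logKernel
  exact (ENNReal.measurable_log.comp (by fun_prop)).neg

@[fun_prop]
lemma measurable_shiftedKernel (L : ℝ) : Measurable fun p : ℂ × ℂ => shiftedKernel L p.1 p.2 :=
  (Measurable.add_const measurable_logKernel (L : EReal)).ereal_toENNReal

lemma measurable_shiftedKernel_right (L : ℝ) (z : ℂ) : Measurable (shiftedKernel L z) :=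
  Measurable.of_uncurry_left (f := shiftedKernel L) (measurable_shiftedKernel L)

/-- Frullani's integral with endpoints `|z - w|²` and `D²`; the squares account for the factor `2`.
On the diagonal both sides are infinite. -/
lemma two_mul_shiftedKernel {D : ℝ} (hD : 0 < D) {z w : ℂ} (h : ‖z - w‖ ≤ D) :
    2 * shiftedKernel (Real.log D) z w = ∫⁻ t in Ioi (0 : ℝ),
      ENNReal.ofReal (t⁻¹ * (Real.exp (-(t * ‖z - w‖ ^ 2)) - Real.exp (-(t * D ^ 2)))) := by
  rw [lintegral_frullani (by positivity) (by gcongr)]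
  rcases eq_or_ne z w with rfl | hzw
  · rw [shiftedKernel_self]
    simpa using! (lintegral_Ioc_zero_inv (pow_pos hD 2)).symm
  · have hpos := norm_sub_pos_iff.2 hzw
    rw [lintegral_Ioc_inv (by positivity) (by gcongr), shiftedKernel_of_ne _ hzw, Real.log_pow,
      Real.log_pow, ← mul_sub, ENNReal.ofReal_mul (by simp)]
    simp

/-- The integrand in the representation of the shifted energy by Gaussian energies. -/
def gaussEnergyDiff (D : ℝ) (ν ν' : Measure ℂ) (t : ℝ) : ℝ≥0∞ :=
  ENNReal.ofReal t⁻¹ * (gaussEnergy ν ν' t - ENNReal.ofReal (Real.exp (-(t * D ^ 2))))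

lemma measurable_gaussEnergy (ν ν' : Measure ℂ) [SFinite ν] [SFinite ν'] :
    Measurable (gaussEnergy ν ν') := by
  unfold gaussEnergy
  refine Measurable.lintegral_prod_right' (f := fun p : ℝ × ℂ =>
    ∫⁻ w, ENNReal.ofReal (Real.exp (-p.1 * ‖p.2 - w‖ ^ 2)) ∂ν') ?_
  exact Measurable.lintegral_prod_right' (f := fun p : (ℝ × ℂ) × ℂ =>
    ENNReal.ofReal (Real.exp (-p.1.1 * ‖p.1.2 - p.2‖ ^ 2))) (by fun_prop)

lemma measurable_gaussEnergyDiff (D : ℝ) (ν ν' : Measure ℂ) [SFinite ν] [SFinite ν'] :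
    Measurable (gaussEnergyDiff D ν ν') := by
  have := measurable_gaussEnergy ν ν'
  unfold gaussEnergyDiff
  fun_prop

/-- Guarantees that the truncated subtraction in `gaussEnergyDiff` loses nothing. -/
lemma exp_le_gaussEnergy {D t : ℝ} (ht : 0 < t) {ν ν' : Measure ℂ} [IsProbabilityMeasure ν]
    [IsProbabilityMeasure ν'] (h : ∀ᵐ z ∂ν, ∀ᵐ w ∂ν', ‖z - w‖ ≤ D) :
    ENNReal.ofReal (Real.exp (-(t * D ^ 2))) ≤ gaussEnergy ν ν' t := by
  calc ENNReal.ofReal (Real.exp (-(t * D ^ 2)))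
      = ∫⁻ _, ∫⁻ _, ENNReal.ofReal (Real.exp (-(t * D ^ 2))) ∂ν' ∂ν := by simp
    _ ≤ gaussEnergy ν ν' t := by
      refine lintegral_mono_ae (h.mono fun z hz => lintegral_mono_ae (hz.mono fun w hw => ?_))
      rw [neg_mul]
      gcongr

lemma lintegral_lintegral_gauss_sub {D t : ℝ} (ht : 0 < t) {ν ν' : Measure ℂ}
    [IsProbabilityMeasure ν] [IsProbabilityMeasure ν'] (h : ∀ᵐ z ∂ν, ∀ᵐ w ∂ν', ‖z - w‖ ≤ D) :
    ∫⁻ z, ∫⁻ w, ENNReal.ofReal (t⁻¹ * (Real.exp (-(t * ‖z - w‖ ^ 2)) - Real.exp (-(t * D ^ 2))))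
      ∂ν' ∂ν = gaussEnergyDiff D ν ν' t := by
  have hc : ENNReal.ofReal (Real.exp (-(t * D ^ 2))) =
      ∫⁻ _, ENNReal.ofReal (Real.exp (-(t * D ^ 2))) ∂ν' := by simp
  have hle (z : ℂ) (hz : ∀ᵐ w ∂ν', ‖z - w‖ ≤ D) :
      (fun _ => ENNReal.ofReal (Real.exp (-(t * D ^ 2)))) ≤ᵐ[ν']
        fun w => ENNReal.ofReal (Real.exp (-t * ‖z - w‖ ^ 2)) := hz.mono fun w hw => by
    dsimp only
    rw [neg_mul]
    gcongr
  have h1 (z : ℂ) (hz : ∀ᵐ w ∂ν', ‖z - w‖ ≤ D) :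
      ∫⁻ w, ENNReal.ofReal (t⁻¹ * (Real.exp (-(t * ‖z - w‖ ^ 2)) - Real.exp (-(t * D ^ 2)))) ∂ν' =
      ENNReal.ofReal t⁻¹ * (∫⁻ w, ENNReal.ofReal (Real.exp (-t * ‖z - w‖ ^ 2)) ∂ν' -
        ENNReal.ofReal (Real.exp (-(t * D ^ 2)))) := by
    nth_rewrite 1 [hc]
    rw [← lintegral_sub (by fun_prop) (by simp) (hle z hz), ← lintegral_const_mul _ (by fun_prop)]
    refine lintegral_congr fun w => ?_
    rw [ENNReal.ofReal_mul (inv_pos.2 ht).le, ENNReal.ofReal_sub _ (Real.exp_pos _).le, neg_mul]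
  rw [lintegral_congr_ae (h.mono h1)]
  have hmeas : Measurable fun z => ∫⁻ w, ENNReal.ofReal (Real.exp (-t * ‖z - w‖ ^ 2)) ∂ν' :=
    Measurable.lintegral_prod_right' (f := fun p : ℂ × ℂ =>
      ENNReal.ofReal (Real.exp (-t * ‖p.1 - p.2‖ ^ 2))) (by fun_prop)
  rw [lintegral_const_mul _ (by fun_prop), lintegral_sub (by fun_prop) (by simp)]
  · simp [gaussEnergyDiff, gaussEnergy]
  · refine h.mono fun z hz => ?_
    dsimp only
    nth_rewrite 1 [hc]
    exact lintegral_mono_ae (hle z hz)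

/-- The shifted logarithmic energy as a superposition of Gaussian energies. -/
lemma two_mul_shiftedEnergy {D : ℝ} (hD : 0 < D) {ν ν' : Measure ℂ} [IsProbabilityMeasure ν]
    [IsProbabilityMeasure ν'] (h : ∀ᵐ z ∂ν, ∀ᵐ w ∂ν', ‖z - w‖ ≤ D) :
    2 * shiftedEnergy (Real.log D) ν ν' = ∫⁻ t in Ioi (0 : ℝ), gaussEnergyDiff D ν ν' t := by
  set F : ℂ → ℂ → ℝ → ℝ≥0∞ := fun z w t =>
    ENNReal.ofReal (t⁻¹ * (Real.exp (-(t * ‖z - w‖ ^ 2)) - Real.exp (-(t * D ^ 2))))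
  calc 2 * shiftedEnergy (Real.log D) ν ν'
      = ∫⁻ z, ∫⁻ w, 2 * shiftedKernel (Real.log D) z w ∂ν' ∂ν := by
        rw [shiftedEnergy, ← lintegral_const_mul _
          (measurable_shiftedKernel (Real.log D)).lintegral_prod_right']
        refine lintegral_congr fun z => ?_
        exact (lintegral_const_mul _ (measurable_shiftedKernel_right _ z)).symm
    _ = ∫⁻ z, ∫⁻ w, ∫⁻ t in Ioi (0 : ℝ), F z w t ∂volume ∂ν' ∂ν :=
        lintegral_congr_ae (h.mono fun z hz => lintegral_congr_ae (hz.mono fun w hw =>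
          two_mul_shiftedKernel hD hw))
    _ = ∫⁻ z, ∫⁻ t in Ioi (0 : ℝ), ∫⁻ w, F z w t ∂ν' ∂volume ∂ν :=
        lintegral_congr fun z => lintegral_lintegral_swap (by fun_prop)
    _ = ∫⁻ t in Ioi (0 : ℝ), ∫⁻ z, ∫⁻ w, F z w t ∂ν' ∂ν := by
        refine lintegral_lintegral_swap (Measurable.aemeasurable ?_)
        exact Measurable.lintegral_prod_right' (f := fun p : (ℂ × ℝ) × ℂ => F p.1.1 p.2 p.1.2)
          (by fun_prop)
    _ = _ := setLIntegral_congr_fun measurableSet_Ioi fun t ht =>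
        lintegral_lintegral_gauss_sub ht h

lemma two_mul_tsub_le {a b c d : ℝ≥0∞} (ha : d ≤ a) (hb : d ≤ b)
    (h : 2 * c ≤ a + b) : 2 * (c - d) ≤ (a - d) + (b - d) := by
  rw [ENNReal.mul_sub (fun _ _ => by simp), tsub_le_iff_right]
  calc 2 * c ≤ a + b := h
    _ = _ := by
      rw [two_mul, add_add_add_comm, tsub_add_cancel_of_le ha, tsub_add_cancel_of_le hb]

lemma two_mul_eq_of_two_mul_tsub_eq {a b c d : ℝ≥0∞} (ha : d ≤ a)
    (hb : d ≤ b) (hc : d ≤ c) (h : 2 * (c - d) = (a - d) + (b - d)) : 2 * c = a + b := by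
  rw [← tsub_add_cancel_of_le ha, ← tsub_add_cancel_of_le hb, ← tsub_add_cancel_of_le hc, mul_add,
    h, two_mul d, add_add_add_comm]

lemma two_mul_gaussEnergyDiff_le {D t : ℝ} (ht : 0 < t) {ν μ : Measure ℂ} [IsProbabilityMeasure ν]
    [IsProbabilityMeasure μ] (hν : ∀ᵐ z ∂ν, ∀ᵐ w ∂ν, ‖z - w‖ ≤ D)
    (hμ : ∀ᵐ z ∂μ, ∀ᵐ w ∂μ, ‖z - w‖ ≤ D) :
    2 * gaussEnergyDiff D ν μ t ≤ gaussEnergyDiff D ν ν t + gaussEnergyDiff D μ μ t := by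
  unfold gaussEnergyDiff
  rw [mul_left_comm, ← mul_add]
  gcongr
  exact two_mul_tsub_le (exp_le_gaussEnergy ht hν) (exp_le_gaussEnergy ht hμ)
    (two_mul_gaussEnergy_le ht ν μ)

/-- The logarithmic energy of the difference of two probability measures is nonnegative. -/
theorem two_mul_shiftedEnergy_le {D : ℝ} (hD : 0 < D) {ν μ : Measure ℂ} [IsProbabilityMeasure ν]
    [IsProbabilityMeasure μ] (hν : ∀ᵐ z ∂ν, ∀ᵐ w ∂ν, ‖z - w‖ ≤ D)
    (hμ : ∀ᵐ z ∂μ, ∀ᵐ w ∂μ, ‖z - w‖ ≤ D) (hνμ : ∀ᵐ z ∂ν, ∀ᵐ w ∂μ, ‖z - w‖ ≤ D) :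
    2 * shiftedEnergy (Real.log D) ν μ ≤
      shiftedEnergy (Real.log D) ν ν + shiftedEnergy (Real.log D) μ μ := by
  refine (ENNReal.mul_le_mul_iff_right two_ne_zero (by simp : (2 : ℝ≥0∞) ≠ ⊤)).1 ?_
  rw [mul_add, two_mul_shiftedEnergy hD hν, two_mul_shiftedEnergy hD hμ,
    two_mul_shiftedEnergy hD hνμ, ← lintegral_add_left (measurable_gaussEnergyDiff D ν ν),
    ← lintegral_const_mul _ (measurable_gaussEnergyDiff D ν μ)]
  exact setLIntegral_mono' measurableSet_Ioi fun t ht => two_mul_gaussEnergyDiff_le ht hν hμ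

/-- The logarithmic energy of the difference of two distinct probability measures of finite energy
does not vanish. -/
theorem eq_of_shiftedEnergy_le {D : ℝ} (hD : 0 < D) {ν μ : Measure ℂ} [IsProbabilityMeasure ν]
    [IsProbabilityMeasure μ] (hν : ∀ᵐ z ∂ν, ∀ᵐ w ∂ν, ‖z - w‖ ≤ D)
    (hμ : ∀ᵐ z ∂μ, ∀ᵐ w ∂μ, ‖z - w‖ ≤ D) (hνμ : ∀ᵐ z ∂ν, ∀ᵐ w ∂μ, ‖z - w‖ ≤ D)
    (hfin : shiftedEnergy (Real.log D) ν μ ≠ ⊤)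
    (hle : shiftedEnergy (Real.log D) ν ν + shiftedEnergy (Real.log D) μ μ ≤
      2 * shiftedEnergy (Real.log D) ν μ) : ν = μ := by
  have hle2 := mul_le_mul_right hle (2 : ℝ≥0∞)
  rw [mul_add, two_mul_shiftedEnergy hD hν, two_mul_shiftedEnergy hD hμ,
    two_mul_shiftedEnergy hD hνμ, ← lintegral_add_left (measurable_gaussEnergyDiff D ν ν),
    ← lintegral_const_mul _ (measurable_gaussEnergyDiff D ν μ)] at hle2
  have hae := ae_eq_of_ae_le_of_lintegral_le (μ := volume.restrict (Ioi (0 : ℝ)))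
    ((ae_restrict_mem measurableSet_Ioi).mono fun t ht => two_mul_gaussEnergyDiff_le ht hν hμ)
    (by
      rw [lintegral_const_mul _ (measurable_gaussEnergyDiff D ν μ), ← two_mul_shiftedEnergy hD hνμ]
      exact ENNReal.mul_ne_top (by simp) (ENNReal.mul_ne_top (by simp) hfin))
    ((measurable_gaussEnergyDiff D ν ν).add (measurable_gaussEnergyDiff D μ μ)).aemeasurable hle2
  -- Equality holds for almost every scale `t`; one positive scale is enough, because the transform
  -- at that scale already determines the measure.
  have : NeZero (volume.restrict (Ioi (0 : ℝ))) := ⟨by simp⟩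
  obtain ⟨t, hteq, ht⟩ := (hae.and (ae_restrict_mem measurableSet_Ioi)).exists
  have ht : 0 < t := ht
  refine eq_of_gaussTransform_eq ht (gaussTransform_eq_of_gaussEnergy ht ν μ ?_)
  refine two_mul_eq_of_two_mul_tsub_eq (exp_le_gaussEnergy ht hν) (exp_le_gaussEnergy ht hμ)
    (exp_le_gaussEnergy ht hνμ) ?_
  simp only [gaussEnergyDiff] at hteq
  rw [mul_left_comm, ← mul_add] at hteq
  exact (ENNReal.mul_right_inj (ENNReal.ofReal_pos.2 (inv_pos.2 ht)).ne' (by simp)).1 hteq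

/-! ### Circle potentials and polar coordinates. -/

/-- On the open interval the circle passes through `z` at most once, so the singularity of the
kernel is invisible to the angular integral. -/
lemma ae_circleMap_ne {r : ℝ} (hr : 0 < r) (z : ℂ) :
    ∀ᵐ θ ∂volume.restrict (Ioo (-Real.pi) Real.pi), circleMap 0 r θ ≠ z := by
  rw [ae_restrict_iff' measurableSet_Ioo, ae_iff]
  refine Set.Subsingleton.measure_zero (fun a ha b hb => ?_) _
  simp only [Classical.not_imp, not_not, mem_ofPred_eq] at ha hb
  refine eq_of_circleMap_eq hr.ne' (c := 0) ?_ (ha.2.trans hb.2.symm)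
  rw [abs_lt]
  constructor <;> linarith [ha.1.1, ha.1.2, hb.1.1, hb.1.2]

/-- The potential of a circle for the shifted kernel. -/
lemma lintegral_shiftedKernel_circleMap {L r : ℝ} (hr : 0 < r) {z : ℂ}
    (hz : ‖z‖ + r ≤ Real.exp L) :
    ∫⁻ θ in Ioo (-Real.pi) Real.pi, shiftedKernel L z (circleMap 0 r θ) =
      ENNReal.ofReal (2 * Real.pi * (L - Real.log (max ‖z‖ r))) := by
  have hπ := Real.pi_pos
  have hle : -Real.pi ≤ Real.pi := by linarith
  have hper : Function.Periodic (fun θ => Real.log ‖circleMap 0 r θ - z‖) (2 * Real.pi) :=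
    fun x => by simp [periodic_circleMap 0 r x]
  have hci : IntervalIntegrable (fun θ => Real.log ‖circleMap 0 r θ - z‖) volume
      (-Real.pi) Real.pi := hper.intervalIntegrable₀ (by positivity)
        (circleIntegrable_log_norm_sub_const (a := z) (c := 0) r) _ _
  -- Jensen's formula for a linear factor; `hmax` rewrites `log r + log⁺(|z|/r)` as `log max(|z|,
  -- r)`.
  have hav := circleAverage_log_norm_sub_const_eq_log_radius_add_posLog (a := z) (c := 0) hr.ne'
  have hmax : Real.log r + Real.posLog (r⁻¹ * ‖0 - z‖) = Real.log (max ‖z‖ r) := by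
    rw [Real.posLog_eq_log_max_one (by positivity), ← Real.log_mul hr.ne' (by positivity),
      mul_max_of_nonneg _ _ hr.le, mul_one, zero_sub, norm_neg, mul_inv_cancel_left₀ hr.ne',
      max_comm]
  rw [hmax, Real.circleAverage_def, smul_eq_mul, inv_mul_eq_iff_eq_mul₀ (by positivity)] at hav
  have hint : ∫ θ in (-Real.pi)..Real.pi, Real.log ‖circleMap 0 r θ - z‖ =
      2 * Real.pi * Real.log (max ‖z‖ r) := by
    rw [← hav]
    have := hper.intervalIntegral_add_eq (-Real.pi) 0
    rwa [zero_add, show -Real.pi + 2 * Real.pi = Real.pi by ring] at this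
  have hae : ∀ᵐ θ ∂volume.restrict (Ioo (-Real.pi) Real.pi),
      shiftedKernel L z (circleMap 0 r θ) =
        ENNReal.ofReal (L - Real.log ‖circleMap 0 r θ - z‖) :=
    (ae_circleMap_ne hr z).mono fun θ hθ => by rw [shiftedKernel_of_ne _ hθ.symm, norm_sub_rev]
  have hnn : ∀ᵐ θ ∂volume.restrict (Ioo (-Real.pi) Real.pi),
      0 ≤ L - Real.log ‖circleMap 0 r θ - z‖ := (ae_circleMap_ne hr z).mono fun θ hθ => by
    rw [sub_nonneg, Real.log_le_iff_le_exp (norm_sub_pos_iff.2 hθ)]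
    refine (norm_sub_le _ _).trans ?_
    rwa [norm_circleMap_zero, abs_of_pos hr, add_comm]
  have hi : IntervalIntegrable (fun θ => L - Real.log ‖circleMap 0 r θ - z‖) volume
      (-Real.pi) Real.pi := intervalIntegrable_const.sub hci
  rw [lintegral_congr_ae hae, ← ofReal_integral_eq_lintegral_ofReal
    ((intervalIntegrable_iff_integrableOn_Ioo_of_le hle).1 hi) hnn, ← integral_Ioc_eq_integral_Ioo,
    ← intervalIntegral.integral_of_le hle, intervalIntegral.integral_sub (by simp) hci, hint]
  congr 1
  rw [intervalIntegral.integral_const, smul_eq_mul]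
  ring

@[fun_prop]
lemma measurable_eqDensity (g : ℝ → ℝ) : Measurable (eqDensity g) := by
  unfold eqDensity
  have := measurable_deriv g
  have := measurable_deriv (deriv g)
  fun_prop

/-- Integration in polar coordinates against a radial measure. -/
lemma lintegral_radialMeasure {ρ : ℝ → ℝ} (hρ : Measurable ρ) (T : ℝ) {F : ℂ → ℝ≥0∞}
    (hF : Measurable F) :
    ∫⁻ z, F z ∂(radialMeasure ρ T) = ∫⁻ r in Ioc 0 T, ENNReal.ofReal (r * ρ r) *
      ∫⁻ θ in Ioo (-Real.pi) Real.pi, F (circleMap 0 r θ) := by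
  have hdisc : MeasurableSet {z : ℂ | ‖z‖ ≤ T} := measurableSet_le (by fun_prop) (by fun_prop)
  have hsymm (p : ℝ × ℝ) : Complex.polarCoord.symm p = circleMap 0 p.1 p.2 := by
    rw [Complex.polarCoord_symm_apply, circleMap_zero, Complex.exp_mul_I]
    simp
  have hcm : Measurable fun p : ℝ × ℝ => circleMap 0 p.1 p.2 := by
    unfold circleMap
    fun_prop
  rw [radialMeasure, lintegral_withDensity_eq_lintegral_mul _ (by fun_prop) hF,
    ← lintegral_indicator hdisc, ← Complex.lintegral_comp_polarCoord_symm, polarCoord_target,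
    Measure.volume_eq_prod, ← Measure.prod_restrict]
  simp_rw [hsymm]
  rw [lintegral_prod]
  · rw [show (Ioc 0 T : Set ℝ) = Ioi 0 ∩ Iic T from Ioi_inter_Iic.symm, inter_comm,
      ← Measure.restrict_restrict measurableSet_Iic, ← lintegral_indicator measurableSet_Iic]
    refine setLIntegral_congr_fun measurableSet_Ioi fun r hr => ?_
    have hr : 0 < r := hr
    by_cases hrT : r ≤ T
    · rw [indicator_of_mem (by exact hrT), ← lintegral_const_mul _ (by fun_prop)]
      refine lintegral_congr fun θ => ?_
      rw [indicator_of_mem (by simpa [abs_of_pos hr] using hrT)]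
      simp only [Pi.mul_apply, norm_circleMap_zero, abs_of_pos hr, smul_eq_mul]
      rw [ENNReal.ofReal_mul hr.le, mul_assoc]
    · rw [indicator_of_notMem (by simpa using hrT)]
      refine (lintegral_congr fun θ => ?_).trans lintegral_zero
      rw [indicator_of_notMem (by simpa [abs_of_pos hr] using hrT), smul_zero]
  · exact (Measurable.smul (by fun_prop : Measurable fun p : ℝ × ℝ => ENNReal.ofReal p.1)
      ((Measurable.indicator (Measurable.mul (f := fun z : ℂ => ENNReal.ofReal (ρ ‖z‖))
        (by fun_prop) hF) hdisc).comp hcm)).aemeasurable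

lemma lintegral_radialMeasure_norm {ρ : ℝ → ℝ} (hρ : Measurable ρ) (T : ℝ) {f : ℝ → ℝ≥0∞}
    (hf : Measurable fun z : ℂ => f ‖z‖) :
    ∫⁻ z, f ‖z‖ ∂(radialMeasure ρ T) =
      ∫⁻ r in Ioc 0 T, ENNReal.ofReal (2 * Real.pi * (r * ρ r)) * f r := by
  rw [lintegral_radialMeasure hρ T hf]
  refine setLIntegral_congr_fun measurableSet_Ioc fun r hr => ?_
  have hπ := Real.pi_pos
  simp only [norm_circleMap_zero, abs_of_pos hr.1, lintegral_const, Measure.restrict_apply,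
    MeasurableSet.univ, univ_inter, Real.volume_Ioo]
  rw [mul_comm (f r), ← mul_assoc, mul_comm (2 * Real.pi),
    ENNReal.ofReal_mul' (mul_pos two_pos hπ).le, sub_neg_eq_add, ← two_mul]

/-- The fundamental theorem of calculus for a nonnegative derivative. -/
lemma setLIntegral_deriv_of_nonneg {f f' : ℝ → ℝ} {a b : ℝ} (hab : a ≤ b)
    (hcont : ContinuousOn f (Icc a b)) (hderiv : ∀ x ∈ Ioo a b, HasDerivAt f (f' x) x)
    (hpos : ∀ x ∈ Ioo a b, 0 ≤ f' x) :
    ∫⁻ x in Ioc a b, ENNReal.ofReal (f' x) = ENNReal.ofReal (f b - f a) := by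
  have hi := intervalIntegral.integrableOn_deriv_of_nonneg hcont hderiv hpos
  rw [← intervalIntegral.integral_eq_sub_of_hasDerivAt_of_le hab hcont hderiv
    ((intervalIntegrable_iff_integrableOn_Ioc_of_le hab).2 hi),
    intervalIntegral.integral_of_le hab, ofReal_integral_eq_lintegral_ofReal hi]
  rw [EventuallyLE, ← restrict_Ioo_eq_restrict_Ioc]
  exact (ae_restrict_mem measurableSet_Ioo).mono hpos

/-! ### The candidate measure and its potential. -/

/-- The derivative of `r g'(r)`. -/
def massDeriv (g : ℝ → ℝ) (r : ℝ) : ℝ := deriv g r + r * deriv (deriv g) r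

/-- The radial mass density is an exact derivative, that of `r g'(r) / 2`; this is why all the
radial integrals below are explicit. -/
lemma eqDensity_eq {g : ℝ → ℝ} {r : ℝ} (hr : 0 < r) :
    2 * Real.pi * (r * eqDensity g r) = 2⁻¹ * massDeriv g r := by
  have := Real.pi_pos
  unfold eqDensity massDeriv
  field_simp
  ring

@[fun_prop]
lemma measurable_massDeriv (g : ℝ → ℝ) : Measurable (massDeriv g) := by
  unfold massDeriv
  have := measurable_deriv g
  have := measurable_deriv (deriv g)
  fun_prop

lemma two_mul_ofReal (x : ℝ) : ENNReal.ofReal (2 * x) = 2 * ENNReal.ofReal x := by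
  rw [ENNReal.ofReal_mul zero_le_two, ENNReal.ofReal_ofNat]

lemma lintegral_eqDensity_norm (g : ℝ → ℝ) (T : ℝ) {f : ℝ → ℝ≥0∞}
    (hf : Measurable fun z : ℂ => f ‖z‖) :
    2 * ∫⁻ z, f ‖z‖ ∂(radialMeasure (eqDensity g) T) =
      ∫⁻ r in Ioc 0 T, ENNReal.ofReal (massDeriv g r) * f r := by
  rw [lintegral_radialMeasure_norm (by fun_prop) T hf, ← lintegral_const_mul' _ _ (by simp)]
  refine setLIntegral_congr_fun measurableSet_Ioc fun r hr => ?_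
  simp only [eqDensity_eq hr.1]
  rw [← mul_assoc, ← two_mul_ofReal, mul_inv_cancel_left₀ two_ne_zero]

namespace IsRadialProfile

variable {g : ℝ → ℝ}

lemma deriv_nonneg (hg : IsRadialProfile g) {r : ℝ} (hr : 0 < r) : 0 ≤ deriv g r := by
  have := (hg.monotoneOn.mono Ioi_subset_Ici_self).derivWithin_nonneg (x := r)
  rwa [derivWithin_of_isOpen isOpen_Ioi hr] at this

lemma hasDerivAt (hg : IsRadialProfile g) {r : ℝ} (hr : 0 < r) : HasDerivAt g (deriv g r) r :=
  (hg.differentiableAt r hr).hasDerivAt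

lemma hasDerivAt_mul_deriv (hg : IsRadialProfile g) {r : ℝ} (hr : 0 < r) :
    HasDerivAt (fun r => r * deriv g r) (massDeriv g r) r := by
  have := (hasDerivAt_id' r).mul (hg.differentiableAt_deriv r hr).hasDerivAt
  rwa [one_mul] at this

lemma massDeriv_nonneg (hg : IsRadialProfile g) {r : ℝ} (hr : 0 < r) : 0 ≤ massDeriv g r := by
  have := hg.monotoneOn_mul_deriv.derivWithin_nonneg (x := r)
  rwa [derivWithin_of_isOpen isOpen_Ioi hr, (hg.hasDerivAt_mul_deriv hr).deriv] at this

lemma eqDensity_nonneg (hg : IsRadialProfile g) {r : ℝ} (hr : 0 < r) : 0 ≤ eqDensity g r := by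
  have h := hg.massDeriv_nonneg hr
  have := Real.pi_pos
  by_contra! hneg
  have := eqDensity_eq (g := g) hr
  have : 2 * Real.pi * (r * eqDensity g r) < 0 :=
    mul_neg_of_pos_of_neg (by positivity) (mul_neg_of_pos_of_neg hr hneg)
  linarith

/-- At `0` the product vanishes whatever value `deriv g 0` takes, which matches the assumed limit.
-/
lemma continuousOn_mul_deriv (hg : IsRadialProfile g) :
    ContinuousOn (fun r => r * deriv g r) (Ici 0) := by
  intro r hr
  rcases (show (0 : ℝ) ≤ r from hr).eq_or_lt with rfl | hr
  · rw [← continuousWithinAt_Ioi_iff_Ici, ContinuousWithinAt]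
    simpa using hg.tendsto_zero
  · exact (hg.hasDerivAt_mul_deriv hr).continuousAt.continuousWithinAt

lemma mul_deriv_nonneg (hg : IsRadialProfile g) {r : ℝ} (hr : 0 ≤ r) : 0 ≤ r * deriv g r := by
  rcases hr.eq_or_lt with rfl | hr
  · simp
  · exact mul_nonneg hr.le (hg.deriv_nonneg hr)

lemma lintegral_massDeriv (hg : IsRadialProfile g) {a b : ℝ} (ha : 0 ≤ a) (hab : a ≤ b) :
    ∫⁻ r in Ioc a b, ENNReal.ofReal (massDeriv g r) =
      ENNReal.ofReal (b * deriv g b - a * deriv g a) :=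
  setLIntegral_deriv_of_nonneg hab
    (hg.continuousOn_mul_deriv.mono (Icc_subset_Ici_self.trans (Ici_subset_Ici.2 ha)))
    (fun _ hr => hg.hasDerivAt_mul_deriv (ha.trans_lt hr.1))
    (fun _ hr => hg.massDeriv_nonneg (ha.trans_lt hr.1))

/-- The equilibrium measure is a probability measure. -/
lemma isProbabilityMeasure (hg : IsRadialProfile g) {T : ℝ} (hT : 0 < T) (hgT : T * deriv g T = 2) :
    IsProbabilityMeasure (radialMeasure (eqDensity g) T) := by
  have h := lintegral_eqDensity_norm g T (f := fun _ => 1) (by fun_prop)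
  simp only [mul_one, lintegral_one] at h
  rw [hg.lintegral_massDeriv le_rfl hT.le, hgT] at h
  refine ⟨(ENNReal.mul_right_inj two_ne_zero (by simp)).1 (h.trans ?_)⟩
  simp

lemma two_mul_lintegral_shiftedKernel (hg : IsRadialProfile g) {T L : ℝ} {z : ℂ}
    (hL : ‖z‖ + T ≤ Real.exp L) :
    2 * ∫⁻ w, shiftedKernel L z w ∂(radialMeasure (eqDensity g) T) =
      ∫⁻ r in Ioc 0 T, ENNReal.ofReal (massDeriv g r * (L - Real.log (max ‖z‖ r))) := by
  rw [lintegral_radialMeasure (by fun_prop) T (measurable_shiftedKernel_right L z),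
    ← lintegral_const_mul' _ _ (by simp)]
  refine setLIntegral_congr_fun measurableSet_Ioc fun r hr => ?_
  rw [lintegral_shiftedKernel_circleMap hr.1 (by linarith [hr.2]),
    ← ENNReal.ofReal_mul (mul_nonneg hr.1.le (hg.eqDensity_nonneg hr.1)), ← two_mul_ofReal]
  congr 1
  linear_combination 2 * (L - Real.log (max ‖z‖ r)) * eqDensity_eq (g := g) hr.1

/-- An antiderivative found by parts: differentiating the logarithm yields `-g'`, which the summand
`g` cancels. -/
lemma hasDerivAt_mul_log_add (hg : IsRadialProfile g) (L : ℝ) {r : ℝ} (hr : 0 < r) :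
    HasDerivAt (fun r => r * deriv g r * (L - Real.log r) + g r)
      (massDeriv g r * (L - Real.log r)) r := by
  have := ((hg.hasDerivAt_mul_deriv hr).mul ((Real.hasDerivAt_log hr.ne').const_sub L)).add
    (hg.hasDerivAt hr)
  convert! this using 1
  field_simp
  ring

lemma massDeriv_mul_log_nonneg (hg : IsRadialProfile g) {L r : ℝ} (hr : 0 < r)
    (hL : r ≤ Real.exp L) : 0 ≤ massDeriv g r * (L - Real.log r) :=
  mul_nonneg (hg.massDeriv_nonneg hr) (sub_nonneg.2 ((Real.log_le_iff_le_exp hr).2 hL))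

lemma setLIntegral_massDeriv_mul_log (hg : IsRadialProfile g) {T L x : ℝ} (hx : 0 < x)
    (hxT : x ≤ T) (hL : T ≤ Real.exp L) :
    ∫⁻ r in Ioc x T, ENNReal.ofReal (massDeriv g r * (L - Real.log r)) =
      ENNReal.ofReal (T * deriv g T * (L - Real.log T) + g T -
        (x * deriv g x * (L - Real.log x) + g x)) :=
  setLIntegral_deriv_of_nonneg (f := fun r => r * deriv g r * (L - Real.log r) + g r) hxT
    (fun _ hr => (hg.hasDerivAt_mul_log_add L (hx.trans_le hr.1)).continuousAt.continuousWithinAt)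
    (fun _ hr => hg.hasDerivAt_mul_log_add L (hx.trans hr.1))
    fun _ hr => hg.massDeriv_mul_log_nonneg (hx.trans hr.1) (hr.2.le.trans hL)

/-- Keeps the increment of the antiderivative nonnegative, so that `ENNReal.ofReal` is additive when
the inner and outer contributions are summed. -/
lemma monotoneOn_mul_log_add (hg : IsRadialProfile g) (L : ℝ) :
    MonotoneOn (fun r => r * deriv g r * (L - Real.log r) + g r) (Ioc 0 (Real.exp L)) := by
  refine monotoneOn_of_deriv_nonneg (convex_Ioc _ _)
    (fun r hr => (hg.hasDerivAt_mul_log_add L hr.1).continuousAt.continuousWithinAt)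
    (fun r hr => ?_) (fun r hr => ?_) <;> rw [interior_Ioc] at hr
  · exact (hg.hasDerivAt_mul_log_add L hr.1).differentiableAt.differentiableWithinAt
  · rw [(hg.hasDerivAt_mul_log_add L hr.1).deriv]
    exact hg.massDeriv_mul_log_nonneg hr.1 hr.2.le

/-- The potential of the equilibrium measure for the shifted kernel, inside the disk. -/
lemma lintegral_shiftedKernel_of_le (hg : IsRadialProfile g) {T L : ℝ}
    (hgT : T * deriv g T = 2) {z : ℂ} (hz : z ≠ 0) (hzT : ‖z‖ ≤ T) (hL : ‖z‖ + T ≤ Real.exp L) :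
    ∫⁻ w, shiftedKernel L z w ∂(radialMeasure (eqDensity g) T) =
      ENNReal.ofReal (L - Real.log T + (g T - g ‖z‖) / 2) := by
  have hx : 0 < ‖z‖ := norm_pos_iff.2 hz
  have hT : 0 < T := hx.trans_le hzT
  have hlog {r : ℝ} (hr : 0 < r) (hrT : r ≤ T) : 0 ≤ L - Real.log r := by
    rw [sub_nonneg, Real.log_le_iff_le_exp hr]
    linarith
  have hmono : g ‖z‖ ≤ g T := hg.monotoneOn (mem_Ici.2 hx.le) (mem_Ici.2 hT.le) hzT
  refine (ENNReal.mul_right_inj two_ne_zero (by simp)).1 ?_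
  rw [hg.two_mul_lintegral_shiftedKernel hL, ← Ioc_union_Ioc_eq_Ioc hx.le hzT,
    lintegral_union measurableSet_Ioc (Ioc_disjoint_Ioc_of_le le_rfl)]
  have h1 : ∫⁻ r in Ioc 0 ‖z‖, ENNReal.ofReal (massDeriv g r * (L - Real.log (max ‖z‖ r))) =
      ENNReal.ofReal (‖z‖ * deriv g ‖z‖ * (L - Real.log ‖z‖)) := by
    rw [ENNReal.ofReal_mul (hg.mul_deriv_nonneg hx.le)]
    have := hg.lintegral_massDeriv le_rfl hx.le
    rw [zero_mul, sub_zero] at this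
    rw [← this, ← lintegral_mul_const' _ _ (by simp)]
    refine setLIntegral_congr_fun measurableSet_Ioc fun r hr => ?_
    rw [max_eq_left hr.2, ENNReal.ofReal_mul (hg.massDeriv_nonneg hr.1)]
  have h2 : ∫⁻ r in Ioc ‖z‖ T, ENNReal.ofReal (massDeriv g r * (L - Real.log (max ‖z‖ r))) =
      ∫⁻ r in Ioc ‖z‖ T, ENNReal.ofReal (massDeriv g r * (L - Real.log r)) := by
    refine setLIntegral_congr_fun measurableSet_Ioc fun r hr => ?_
    rw [max_eq_right hr.1.le]
  have hle : ‖z‖ * deriv g ‖z‖ * (L - Real.log ‖z‖) + g ‖z‖ ≤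
      T * deriv g T * (L - Real.log T) + g T :=
    hg.monotoneOn_mul_log_add L ⟨hx, by linarith⟩ ⟨hT, by linarith⟩ hzT
  rw [h1, h2, hg.setLIntegral_massDeriv_mul_log hx hzT (by linarith), ← ENNReal.ofReal_add
    (mul_nonneg (hg.mul_deriv_nonneg hx.le) (hlog hx hzT)) (sub_nonneg.2 hle), ← two_mul_ofReal]
  congr 1
  rw [hgT]
  ring

/-- The potential of the equilibrium measure for the shifted kernel, outside the disk. -/
lemma lintegral_shiftedKernel_of_ge (hg : IsRadialProfile g) {T L : ℝ} (hT : 0 < T)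
    (hgT : T * deriv g T = 2) {z : ℂ} (hzT : T ≤ ‖z‖) (hL : ‖z‖ + T ≤ Real.exp L) :
    ∫⁻ w, shiftedKernel L z w ∂(radialMeasure (eqDensity g) T) =
      ENNReal.ofReal (L - Real.log ‖z‖) := by
  refine (ENNReal.mul_right_inj two_ne_zero (by simp)).1 ?_
  have h := hg.lintegral_massDeriv le_rfl hT.le
  rw [hgT, zero_mul, sub_zero, ENNReal.ofReal_ofNat] at h
  rw [hg.two_mul_lintegral_shiftedKernel hL, ← h, ← lintegral_mul_const' _ _ (by simp)]
  refine setLIntegral_congr_fun measurableSet_Ioc fun r hr => ?_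
  rw [max_eq_left (hr.2.trans hzT), ENNReal.ofReal_mul (hg.massDeriv_nonneg hr.1)]

end IsRadialProfile

/-! ### Integrability near the origin and the energy of the candidate. -/

/-- The origin must be discarded because `g 0` may lie strictly below the right limit of `g` at `0`,
and the potential formula sees only that limit. -/
lemma ae_radialMeasure (ρ : ℝ → ℝ) (T : ℝ) :
    ∀ᵐ z ∂(radialMeasure ρ T), z ≠ 0 ∧ ‖z‖ ≤ T := by
  refine (withDensity_absolutelyContinuous _ _).ae_le ?_
  refine Eventually.and ?_ (ae_restrict_mem
    (measurableSet_le (_root_.measurable_norm (α := ℂ)) measurable_const))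
  exact ae_restrict_of_ae (Measure.ae_ne volume 0)

namespace IsRadialProfile

variable {g : ℝ → ℝ}

lemma exists_tendsto_zero (hg : IsRadialProfile g) : ∃ c, Tendsto g (𝓝[>] 0) (𝓝 c) :=
  ⟨_, (hg.monotoneOn.mono Ioi_subset_Ici_self).tendsto_nhdsGT
    ⟨0, by rintro _ ⟨r, hr, rfl⟩; exact hg.nonneg r (le_of_lt hr)⟩⟩

/-- A nonnegative derivative of a function continuous up to the endpoints is integrable; since `g`
may jump at `0`, its value there is first replaced by the right limit. -/
lemma intervalIntegrable_deriv (hg : IsRadialProfile g) {T : ℝ} (hT : 0 < T) :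
    IntervalIntegrable (deriv g) volume 0 T := by
  obtain ⟨c, hc⟩ := hg.exists_tendsto_zero
  rw [intervalIntegrable_iff_integrableOn_Ioc_of_le hT.le]
  have heq {r : ℝ} (hr : 0 < r) : Function.update g 0 c =ᶠ[𝓝 r] g := by
    filter_upwards [Ioi_mem_nhds hr] with x hx
    exact Function.update_of_ne (ne_of_gt hx) _ _
  refine intervalIntegral.integrableOn_deriv_of_nonneg (g := Function.update g 0 c)
    (fun r hr => ?_) (fun r hr => (hg.hasDerivAt hr.1).congr_of_eventuallyEq (heq hr.1))
    fun r hr => hg.deriv_nonneg hr.1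
  rcases hr.1.eq_or_lt with rfl | h0
  · refine (continuousWithinAt_update_same.2 (hc.mono_left (nhdsWithin_mono _ ?_)))
    rintro x ⟨hx, hx0⟩
    exact lt_of_le_of_ne hx.1 (Ne.symm hx0)
  · exact ((hg.hasDerivAt h0).congr_of_eventuallyEq (heq h0)).continuousAt.continuousWithinAt

lemma intervalIntegrable_massDeriv (hg : IsRadialProfile g) {T : ℝ} (hT : 0 < T) :
    IntervalIntegrable (massDeriv g) volume 0 T := by
  rw [intervalIntegrable_iff_integrableOn_Ioc_of_le hT.le]
  exact intervalIntegral.integrableOn_deriv_of_nonneg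
    (hg.continuousOn_mul_deriv.mono Icc_subset_Ici_self)
    (fun r hr => hg.hasDerivAt_mul_deriv hr.1) fun r hr => hg.massDeriv_nonneg hr.1

/-- The integrand is `(r g') · g'`, a continuous function times an integrable one. -/
lemma intervalIntegrable_mul_deriv_sq (hg : IsRadialProfile g) {T : ℝ} (hT : 0 < T) :
    IntervalIntegrable (fun r => r * deriv g r ^ 2) volume 0 T := by
  have := (hg.intervalIntegrable_deriv hT).continuousOn_mul (g := fun r => r * deriv g r)
    (hg.continuousOn_mul_deriv.mono (by rw [uIcc_of_le hT.le]; exact Icc_subset_Ici_self))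
  refine this.congr fun r _ => ?_
  ring

lemma intervalIntegrable_massDeriv_mul (hg : IsRadialProfile g) {T : ℝ} (hT : 0 < T) :
    IntervalIntegrable (fun r => massDeriv g r * g r) volume 0 T := by
  have h := hg.intervalIntegrable_massDeriv hT
  rw [intervalIntegrable_iff_integrableOn_Ioc_of_le hT.le] at h ⊢
  refine Integrable.mul_bdd (c := g T) h ?_ ?_
  · exact ContinuousOn.aestronglyMeasurable
      (fun r hr => (hg.hasDerivAt hr.1).continuousAt.continuousWithinAt) measurableSet_Ioc
  · refine (ae_restrict_mem measurableSet_Ioc).mono fun r hr => ?_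
    rw [Real.norm_of_nonneg (hg.nonneg r hr.1.le)]
    exact hg.monotoneOn (mem_Ici.2 hr.1.le) (mem_Ici.2 hT.le) hr.2

lemma integral_massDeriv (hg : IsRadialProfile g) {T : ℝ} (hT : 0 < T) :
    ∫ r in (0 : ℝ)..T, massDeriv g r = T * deriv g T := by
  rw [intervalIntegral.integral_eq_sub_of_hasDerivAt_of_le hT.le
    (hg.continuousOn_mul_deriv.mono Icc_subset_Ici_self)
    (fun r hr => hg.hasDerivAt_mul_deriv hr.1) (hg.intervalIntegrable_massDeriv hT)]
  simp

/-- Integration by parts for `∫ g d(r g')`. -/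
lemma integral_massDeriv_mul (hg : IsRadialProfile g) {T : ℝ} (hT : 0 < T) :
    ∫ r in (0 : ℝ)..T, massDeriv g r * g r =
      T * deriv g T * g T - ∫ r in (0 : ℝ)..T, r * deriv g r ^ 2 := by
  obtain ⟨c, hc⟩ := hg.exists_tendsto_zero
  have h := intervalIntegral.integral_eq_sub_of_hasDerivAt_of_tendsto hT
    (f := fun r => r * deriv g r * g r) (f' := fun r => massDeriv g r * g r + r * deriv g r ^ 2)
    (fun r hr => by
      have := (hg.hasDerivAt_mul_deriv hr.1).mul (hg.hasDerivAt hr.1)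
      convert! this using 1
      ring)
    ((hg.intervalIntegrable_massDeriv_mul hT).add (hg.intervalIntegrable_mul_deriv_sq hT))
    -- The boundary term at `0` vanishes, as `r g'(r) → 0` and `g` has a finite right limit.
    (hg.tendsto_zero.mul hc)
    (((hg.hasDerivAt_mul_deriv hT).mul (hg.hasDerivAt hT)).continuousAt.tendsto.mono_left
      nhdsWithin_le_nhds)
  rw [intervalIntegral.integral_add (hg.intervalIntegrable_massDeriv_mul hT)
    (hg.intervalIntegrable_mul_deriv_sq hT), zero_mul, sub_zero] at h
  exact eq_sub_of_add_eq h

lemma measurable_norm (hg : IsRadialProfile g) : Measurable fun z : ℂ => g ‖z‖ := by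
  have : Monotone fun r => g (max r 0) := fun a b hab =>
    hg.monotoneOn (mem_Ici.2 (le_max_right _ _)) (mem_Ici.2 (le_max_right _ _))
      (max_le_max_right 0 hab)
  have h := this.measurable.comp (_root_.measurable_norm (α := ℂ))
  convert! h using 2 with z
  simp

/-- The energy of the equilibrium measure for the shifted kernel, plus the energy of the field. -/
lemma shiftedEnergy_add_lintegral (hg : IsRadialProfile g) {T L : ℝ} (hT : 0 < T)
    (hgT : T * deriv g T = 2) (hL : 2 * T ≤ Real.exp L) :
    shiftedEnergy L (radialMeasure (eqDensity g) T) (radialMeasure (eqDensity g) T) +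
      ∫⁻ z, ENNReal.ofReal (g ‖z‖) ∂(radialMeasure (eqDensity g) T) =
      ENNReal.ofReal (L - Real.log T + g T - 1 / 4 * ∫ r in (0 : ℝ)..T, r * deriv g r ^ 2) := by
  -- On the punctured disk the shifted potential is `M - g/2`, so adding the field term `g = 2Q`
  -- leaves `M + g/2`.
  set M : ℝ := L - Real.log T + g T / 2
  have hlog : 0 ≤ L - Real.log T := by
    rw [sub_nonneg, Real.log_le_iff_le_exp hT]
    linarith
  have hM : 0 ≤ M := add_nonneg hlog (div_nonneg (hg.nonneg T hT.le) zero_le_two)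
  have hae : ∀ᵐ z ∂(radialMeasure (eqDensity g) T),
      ∫⁻ w, shiftedKernel L z w ∂(radialMeasure (eqDensity g) T) + ENNReal.ofReal (g ‖z‖) =
        ENNReal.ofReal (M + g ‖z‖ / 2) := by
    filter_upwards [ae_radialMeasure (eqDensity g) T] with z hz
    have hmono : g ‖z‖ ≤ g T := hg.monotoneOn (mem_Ici.2 (norm_nonneg z)) (mem_Ici.2 hT.le) hz.2
    rw [hg.lintegral_shiftedKernel_of_le hgT hz.1 hz.2 (by linarith [hz.2]),
      ← ENNReal.ofReal_add (by linarith) (hg.nonneg _ (norm_nonneg z))]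
    congr 1
    simp only [M]
    ring
  have hmeas : Measurable fun z : ℂ => ENNReal.ofReal (M + g ‖z‖ / 2) :=
    ((hg.measurable_norm.div_const 2).const_add M).ennreal_ofReal
  have hi : IntervalIntegrable (fun r => massDeriv g r * M + massDeriv g r * g r / 2)
      volume 0 T := ((hg.intervalIntegrable_massDeriv hT).mul_const M).add
    ((hg.intervalIntegrable_massDeriv_mul hT).div_const 2)
  rw [shiftedEnergy, ← lintegral_add_right _ hg.measurable_norm.ennreal_ofReal,
    lintegral_congr_ae hae]
  refine (ENNReal.mul_right_inj two_ne_zero (by simp)).1 ?_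
  rw [lintegral_eqDensity_norm g T (f := fun r => ENNReal.ofReal (M + g r / 2)) hmeas,
    ← two_mul_ofReal]
  calc ∫⁻ r in Ioc 0 T, ENNReal.ofReal (massDeriv g r) * ENNReal.ofReal (M + g r / 2)
      = ∫⁻ r in Ioc 0 T, ENNReal.ofReal (massDeriv g r * M + massDeriv g r * g r / 2) := by
        refine setLIntegral_congr_fun measurableSet_Ioc fun r hr => ?_
        rw [← ENNReal.ofReal_mul (hg.massDeriv_nonneg hr.1)]
        congr 1
        ring
    _ = ENNReal.ofReal (∫ r in (0 : ℝ)..T, (massDeriv g r * M + massDeriv g r * g r / 2)) := by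
        rw [intervalIntegral.integral_of_le hT.le, ofReal_integral_eq_lintegral_ofReal
          ((intervalIntegrable_iff_integrableOn_Ioc_of_le hT.le).1 hi)]
        filter_upwards [ae_restrict_mem measurableSet_Ioc] with r hr
        have h1 := hg.massDeriv_nonneg hr.1
        have h2 := hg.nonneg r hr.1.le
        positivity
    _ = _ := by
        rw [intervalIntegral.integral_add ((hg.intervalIntegrable_massDeriv hT).mul_const M)
          ((hg.intervalIntegrable_massDeriv_mul hT).div_const 2),
          intervalIntegral.integral_mul_const, intervalIntegral.integral_div,
          hg.integral_massDeriv hT, hg.integral_massDeriv_mul hT, hgT]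
        congr 1
        simp only [M]
        ring

end IsRadialProfile

/-! ### From extended integrals to shifted integrals. -/

/-- The relation `x⁺ - x⁻ = (x + c) - c` with all terms moved to where they are nonnegative, so that
it survives `x = ⊤`. -/
lemma toENNReal_add_toENNReal_neg {x : EReal} {c : ℝ} (hc : 0 ≤ c) (h : 0 ≤ x + c) :
    (x + c).toENNReal + (-x).toENNReal = x.toENNReal + ENNReal.ofReal c := by
  induction x with
  | bot => simp at h
  | top => simp
  | coe x =>
    rw [← EReal.coe_add, ← EReal.coe_neg, EReal.real_coe_toENNReal, EReal.real_coe_toENNReal,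
      EReal.real_coe_toENNReal]
    have h : 0 ≤ x + c := by exact_mod_cast h
    rcases le_total 0 x with hx | hx
    · rw [ENNReal.ofReal_of_nonpos (neg_nonpos.2 hx), add_zero, ENNReal.ofReal_add hx hc]
    · rw [ENNReal.ofReal_of_nonpos hx, zero_add, ← ENNReal.ofReal_add h (neg_nonneg.2 hx)]
      congr 1
      ring

lemma toENNReal_neg_le {x : EReal} {c : ℝ} (h : 0 ≤ x + c) : (-x).toENNReal ≤ ENNReal.ofReal c := by
  induction x with
  | bot => simp at h
  | top => simp
  | coe x =>
    have h : 0 ≤ x + c := by exact_mod_cast h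
    rw [← EReal.coe_neg, EReal.real_coe_toENNReal]
    exact ENNReal.ofReal_le_ofReal (by linarith)

/-- The extended integral of a function bounded below. -/
lemma extIntegral_eq_sub {ν : Measure ℂ} [IsProbabilityMeasure ν] {f : ℂ → EReal} {c : ℝ}
    (hc : 0 ≤ c) (hf : AEMeasurable f ν) (h : ∀ᵐ z ∂ν, 0 ≤ f z + c) :
    extIntegral ν f = ((∫⁻ z, (f z + c).toENNReal ∂ν : ℝ≥0∞) : EReal) - c := by
  have hsum : ∫⁻ z, (f z + c).toENNReal ∂ν + ∫⁻ z, (-f z).toENNReal ∂ν =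
      ∫⁻ z, (f z).toENNReal ∂ν + ENNReal.ofReal c := by
    have hm : AEMeasurable (fun z => (-f z).toENNReal) ν := AEMeasurable.ereal_toENNReal hf.neg
    rw [← lintegral_add_right' _ hm,
      lintegral_congr_ae (h.mono fun z hz => toENNReal_add_toENNReal_neg hc hz),
      lintegral_add_right _ measurable_const]
    simp
  have hneg : ∫⁻ z, (-f z).toENNReal ∂ν ≠ ⊤ := by
    exact ne_top_of_le_ne_top (b := ∫⁻ _, ENNReal.ofReal c ∂ν) (by simp)
      (lintegral_mono_ae (h.mono fun z hz => toENNReal_neg_le hz))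
  rw [extIntegral]
  generalize ∫⁻ z, (f z + c).toENNReal ∂ν = a at *
  generalize ∫⁻ z, (-f z).toENNReal ∂ν = n at *
  generalize ∫⁻ z, (f z).toENNReal ∂ν = p at *
  lift n to NNReal using hneg
  lift c to NNReal using hc
  rw [ENNReal.ofReal_coe_nnreal] at hsum
  rcases eq_or_ne a ⊤ with rfl | ha
  · have : p = ⊤ := by
      by_contra hp
      rw [top_add] at hsum
      exact ENNReal.add_ne_top.2 ⟨hp, ENNReal.coe_ne_top⟩ hsum.symm
    rw [this]
    rfl
  · have hp : p ≠ ⊤ := by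
      rintro rfl
      rw [top_add] at hsum
      exact ENNReal.add_ne_top.2 ⟨ha, ENNReal.coe_ne_top⟩ hsum
    lift a to NNReal using ha
    lift p to NNReal using hp
    norm_cast at hsum
    have hsum' : (a + n : ℝ) = p + c := by exact_mod_cast hsum
    have : (p - n : ℝ) = a - c := by linarith
    rw [EReal.coe_nnreal_eq_coe_real, EReal.coe_nnreal_eq_coe_real, EReal.coe_nnreal_eq_coe_real]
    exact_mod_cast this

lemma logKernel_add_nonneg {D : ℝ} {z w : ℂ} (h : ‖z - w‖ ≤ D) :
    0 ≤ logKernel z w + (Real.log D : ℝ) := by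
  rcases eq_or_ne z w with rfl | hzw
  · simp [logKernel_self]
  · rw [logKernel_of_ne hzw, ← EReal.coe_add]
    have := Real.log_le_log (norm_sub_pos_iff.2 hzw) h
    exact_mod_cast (by linarith : 0 ≤ -Real.log ‖z - w‖ + Real.log D)

lemma potential_eq_sub {D : ℝ} (hD : 1 ≤ D) {ν : Measure ℂ} [IsProbabilityMeasure ν] {z : ℂ}
    (h : ∀ᵐ w ∂ν, ‖z - w‖ ≤ D) : potential ν z =
      ((∫⁻ w, shiftedKernel (Real.log D) z w ∂ν : ℝ≥0∞) : EReal) - (Real.log D : ℝ) :=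
  extIntegral_eq_sub (Real.log_nonneg hD)
    (Measurable.of_uncurry_left (f := logKernel) measurable_logKernel).aemeasurable
    (h.mono fun _ hw => logKernel_add_nonneg hw)

lemma logEnergy_eq_sub {D : ℝ} (hD : 1 ≤ D) {ν : Measure ℂ} [IsProbabilityMeasure ν]
    (h : ∀ᵐ z ∂ν, ∀ᵐ w ∂ν, ‖z - w‖ ≤ D) :
    logEnergy ν = (shiftedEnergy (Real.log D) ν ν : EReal) - (Real.log D : ℝ) := by
  have hmeas : Measurable fun z =>
      ((∫⁻ w, shiftedKernel (Real.log D) z w ∂ν : ℝ≥0∞) : EReal) - (Real.log D : ℝ) :=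
    ((measurable_shiftedKernel (Real.log D)).lintegral_prod_right'.coe_ereal_ennreal).sub
      measurable_const
  have hpot := h.mono fun z hz => potential_eq_sub hD hz
  rw [logEnergy, extIntegral_eq_sub (Real.log_nonneg hD) ⟨_, hmeas, hpot⟩]
  · congr 2
    refine lintegral_congr_ae (hpot.mono fun z hz => ?_)
    dsimp only
    rw [hz, EReal.sub_add_cancel, EReal.toENNReal_coe]
  · refine hpot.mono fun z hz => ?_
    rw [hz, EReal.sub_add_cancel]
    exact EReal.coe_ennreal_nonneg _

lemma two_mul_extIntegral_radialField {g : ℝ → ℝ} (hg : IsRadialProfile g) (ν : Measure ℂ) :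
    2 * extIntegral ν (fun z => (radialField g z : EReal)) =
      ((∫⁻ z, ENNReal.ofReal (g ‖z‖) ∂ν : ℝ≥0∞) : EReal) := by
  have h0 (z : ℂ) : 0 ≤ radialField g z := div_nonneg (hg.nonneg _ (norm_nonneg z)) zero_le_two
  have h1 : ∫⁻ z, (-(radialField g z : EReal)).toENNReal ∂ν = 0 := by
    refine (lintegral_congr fun z => ?_).trans lintegral_zero
    exact EReal.toENNReal_of_nonpos (by exact_mod_cast neg_nonpos.2 (h0 z))
  rw [extIntegral, h1, EReal.coe_ennreal_zero, sub_zero]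
  have h2 : ∫⁻ z, ENNReal.ofReal (g ‖z‖) ∂ν =
      2 * ∫⁻ z, (radialField g z : EReal).toENNReal ∂ν := by
    rw [← lintegral_const_mul' _ _ (by simp)]
    refine lintegral_congr fun z => ?_
    rw [EReal.real_coe_toENNReal, ← two_mul_ofReal]
    congr 1
    simp only [radialField]
    ring
  rw [h2, EReal.coe_ennreal_mul]
  rfl

lemma weightedEnergy_radialField {g : ℝ → ℝ} (hg : IsRadialProfile g) {D : ℝ} (hD : 1 ≤ D)
    {ν : Measure ℂ} [IsProbabilityMeasure ν] (h : ∀ᵐ z ∂ν, ∀ᵐ w ∂ν, ‖z - w‖ ≤ D) :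
    weightedEnergy (radialField g) ν =
      ((shiftedEnergy (Real.log D) ν ν + ∫⁻ z, ENNReal.ofReal (g ‖z‖) ∂ν : ℝ≥0∞) : EReal) -
        (Real.log D : ℝ) := by
  rw [weightedEnergy, logEnergy_eq_sub hD h, two_mul_extIntegral_radialField hg,
    EReal.coe_ennreal_add, sub_eq_add_neg, sub_eq_add_neg, add_right_comm]

lemma exists_ae_norm_le {E : Set ℂ} {ν : Measure ℂ} (hν : ν ∈ compactProb E) :
    ∃ R : ℝ, ∀ᵐ z ∂ν, ‖z‖ ≤ R := by
  obtain ⟨R, hR⟩ := hν.2.1.isBounded.exists_norm_le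
  exact ⟨R, Filter.mem_of_superset Measure.support_mem_ae fun z hz => hR z hz⟩

lemma ae_ae_norm_sub_le {ν ν' : Measure ℂ} {R : ℝ} (h : ∀ᵐ z ∂ν, ‖z‖ ≤ R)
    (h' : ∀ᵐ z ∂ν', ‖z‖ ≤ R) : ∀ᵐ z ∂ν, ∀ᵐ w ∂ν', ‖z - w‖ ≤ 2 * R :=
  h.mono fun z hz => h'.mono fun w hw => (norm_sub_le z w).trans (by linarith)

/-- A measure of finite logarithmic energy has no atoms. -/
lemma measure_singleton_eq_zero {L : ℝ} {ν : Measure ℂ} (h : shiftedEnergy L ν ν ≠ ⊤) (z : ℂ) :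
    ν {z} = 0 := by
  by_contra hz
  refine h (top_le_iff.1 ?_)
  -- An atom makes the diagonal point `(z, z)` alone contribute infinite energy.
  calc (⊤ : ℝ≥0∞) = (shiftedKernel L z z * ν {z}) * ν {z} := by
        rw [shiftedKernel_self, ENNReal.top_mul hz, ENNReal.top_mul hz]
    _ = (∫⁻ w in {z}, shiftedKernel L z w ∂ν) * ν {z} := by rw [lintegral_singleton]
    _ ≤ (∫⁻ w, shiftedKernel L z w ∂ν) * ν {z} := by
        gcongr ?_ * _
        exact setLIntegral_le_lintegral _ _
    _ = ∫⁻ x in {z}, ∫⁻ w, shiftedKernel L x w ∂ν ∂ν := by rw [lintegral_singleton]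
    _ ≤ shiftedEnergy L ν ν := setLIntegral_le_lintegral _ _

/-! ### Frostman conditions and comparison with competitors. -/

namespace IsRadialProfile

variable {g : ℝ → ℝ}

lemma sub_two_mul_log_le (hg : IsRadialProfile g) {T x : ℝ} (hT : 0 < T) (hgT : T * deriv g T = 2)
    (hx : T ≤ x) : g T - 2 * Real.log T ≤ g x - 2 * Real.log x := by
  have hd {r : ℝ} (hr : T ≤ r) : HasDerivAt (fun r => g r - 2 * Real.log r)
      (deriv g r - 2 * r⁻¹) r :=
    (hg.hasDerivAt (hT.trans_le hr)).sub ((Real.hasDerivAt_log (hT.trans_le hr).ne').const_mul 2)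
  refine monotoneOn_of_deriv_nonneg (convex_Ici T)
    (fun r hr => (hd hr).continuousAt.continuousWithinAt) (fun r hr => ?_) (fun r hr => ?_)
    (mem_Ici.2 le_rfl) (mem_Ici.2 hx) hx <;> rw [interior_Ici] at hr
  · exact (hd (le_of_lt hr)).differentiableAt.differentiableWithinAt
  · have hr' : T < r := hr
    have h0 : 0 < r := hT.trans hr'
    have := hg.monotoneOn_mul_deriv (mem_Ioi.2 hT) (mem_Ioi.2 h0) hr'.le
    simp only [hgT] at this
    rw [(hd hr'.le).deriv, sub_nonneg, ← div_eq_mul_inv, div_le_iff₀ h0]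
    linarith

/-- The equilibrium potential is bounded by its value on the disk. -/
lemma lintegral_shiftedKernel_le (hg : IsRadialProfile g) {T L : ℝ} (hT : 0 < T)
    (hgT : T * deriv g T = 2) {z : ℂ} (hz : z ≠ 0) (hL : ‖z‖ + T ≤ Real.exp L) :
    ∫⁻ w, shiftedKernel L z w ∂(radialMeasure (eqDensity g) T) ≤
      ENNReal.ofReal (L - Real.log T + g T / 2) := by
  have h0 := hg.nonneg T hT.le
  rcases le_total ‖z‖ T with h | h
  · rw [hg.lintegral_shiftedKernel_of_le hgT hz h hL]
    refine ENNReal.ofReal_le_ofReal ?_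
    linarith [hg.nonneg _ (norm_nonneg z)]
  · rw [hg.lintegral_shiftedKernel_of_ge hT hgT h hL]
    refine ENNReal.ofReal_le_ofReal ?_
    linarith [Real.log_le_log hT h]

/-- The Euler–Lagrange equality; the dependence on `g(|z|)` cancels between potential and field. -/
lemma two_mul_lintegral_shiftedKernel_add_of_le (hg : IsRadialProfile g) {T L : ℝ} (hT : 0 < T)
    (hgT : T * deriv g T = 2) {z : ℂ} (hz : z ≠ 0) (hzT : ‖z‖ ≤ T) (hL : ‖z‖ + T ≤ Real.exp L) :
    2 * ∫⁻ w, shiftedKernel L z w ∂(radialMeasure (eqDensity g) T) + ENNReal.ofReal (g ‖z‖) =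
      2 * ENNReal.ofReal (L - Real.log T + g T / 2) := by
  have hmono : g ‖z‖ ≤ g T := hg.monotoneOn (mem_Ici.2 (norm_nonneg z)) (mem_Ici.2 hT.le) hzT
  have hlog : 0 ≤ L - Real.log T := by
    rw [sub_nonneg, Real.log_le_iff_le_exp hT]
    linarith [norm_nonneg z]
  rw [hg.lintegral_shiftedKernel_of_le hgT hz hzT hL, ← two_mul_ofReal, ← two_mul_ofReal,
    ← ENNReal.ofReal_add (by linarith) (hg.nonneg _ (norm_nonneg z))]
  congr 1
  ring

/-- The Euler–Lagrange inequality; outside the disk it amounts to the growth of `g(r) - 2 log r`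
beyond `T`. -/
lemma le_two_mul_lintegral_shiftedKernel_add (hg : IsRadialProfile g) {T L : ℝ} (hT : 0 < T)
    (hgT : T * deriv g T = 2) {z : ℂ} (hz : z ≠ 0) (hL : ‖z‖ + T ≤ Real.exp L) :
    2 * ENNReal.ofReal (L - Real.log T + g T / 2) ≤
    2 * ∫⁻ w, shiftedKernel L z w ∂(radialMeasure (eqDensity g) T) + ENNReal.ofReal (g ‖z‖) := by
  rcases le_total ‖z‖ T with h | h
  · rw [hg.two_mul_lintegral_shiftedKernel_add_of_le hT hgT hz h hL]
  · have hlog : 0 ≤ L - Real.log ‖z‖ := by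
      rw [sub_nonneg, Real.log_le_iff_le_exp (norm_pos_iff.2 hz)]
      linarith
    rw [hg.lintegral_shiftedKernel_of_ge hT hgT h hL, ← two_mul_ofReal, ← two_mul_ofReal,
      ← ENNReal.ofReal_add (by linarith) (hg.nonneg _ (norm_nonneg z))]
    refine ENNReal.ofReal_le_ofReal ?_
    linarith [hg.sub_two_mul_log_le hT hgT h]

lemma radialMeasure_mem_compactProb (hg : IsRadialProfile g) {T : ℝ} (hT : 0 < T)
    (hgT : T * deriv g T = 2) : radialMeasure (eqDensity g) T ∈ compactProb univ := by
  refine ⟨hg.isProbabilityMeasure hT hgT, ?_, subset_univ _⟩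
  refine (isCompact_closedBall (0 : ℂ) T).of_isClosed_subset Measure.isClosed_support
    (Measure.support_subset_of_isClosed Metric.isClosed_closedBall ?_)
  filter_upwards [ae_radialMeasure (eqDensity g) T] with z hz
  simpa using hz.2

end IsRadialProfile

namespace IsRadialProfile

variable {g : ℝ → ℝ}

lemma two_mul_shiftedEnergy_add (hg : IsRadialProfile g) {T L : ℝ} (hT : 0 < T)
    (hgT : T * deriv g T = 2) (hL : 2 * T ≤ Real.exp L) :
    2 * shiftedEnergy L (radialMeasure (eqDensity g) T) (radialMeasure (eqDensity g) T) +
      ∫⁻ z, ENNReal.ofReal (g ‖z‖) ∂(radialMeasure (eqDensity g) T) =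
      2 * ENNReal.ofReal (L - Real.log T + g T / 2) := by
  have := hg.isProbabilityMeasure hT hgT
  rw [shiftedEnergy, ← lintegral_const_mul' _ _ (by simp),
    ← lintegral_add_right _ hg.measurable_norm.ennreal_ofReal]
  have hae : ∀ᵐ z ∂(radialMeasure (eqDensity g) T),
      2 * ∫⁻ w, shiftedKernel L z w ∂(radialMeasure (eqDensity g) T) + ENNReal.ofReal (g ‖z‖) =
        2 * ENNReal.ofReal (L - Real.log T + g T / 2) := by
    filter_upwards [ae_radialMeasure (eqDensity g) T] with z hz
    exact hg.two_mul_lintegral_shiftedKernel_add_of_le hT hgT hz.1 hz.2 (by linarith [hz.2])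
  rw [lintegral_congr_ae hae]
  simp

/-- Supplies finiteness: of the candidate's self-energy, so that it can be cancelled, and of the
mixed energy, as the equality case requires. -/
lemma shiftedEnergy_le (hg : IsRadialProfile g) {T L R : ℝ} (hT : 0 < T)
    (hgT : T * deriv g T = 2) (hTR : T ≤ R) (hL : 2 * R ≤ Real.exp L) {ν : Measure ℂ}
    [IsProbabilityMeasure ν] (hν : ∀ᵐ z ∂ν, ‖z‖ ≤ R) (h0 : ν {0} = 0) :
    shiftedEnergy L ν (radialMeasure (eqDensity g) T) ≤
      ENNReal.ofReal (L - Real.log T + g T / 2) := by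
  calc shiftedEnergy L ν (radialMeasure (eqDensity g) T)
      ≤ ∫⁻ _, ENNReal.ofReal (L - Real.log T + g T / 2) ∂ν := by
        refine lintegral_mono_ae ?_
        filter_upwards [hν, compl_mem_ae_iff.2 h0] with z hz hz0
        exact hg.lintegral_shiftedKernel_le hT hgT hz0 (by linarith)
    _ = _ := by simp

lemma le_two_mul_shiftedEnergy_add (hg : IsRadialProfile g) {T L R : ℝ} (hT : 0 < T)
    (hgT : T * deriv g T = 2) (hTR : T ≤ R) (hL : 2 * R ≤ Real.exp L) {ν : Measure ℂ}
    [IsProbabilityMeasure ν] (hν : ∀ᵐ z ∂ν, ‖z‖ ≤ R) (h0 : ν {0} = 0) :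
    2 * ENNReal.ofReal (L - Real.log T + g T / 2) ≤
      2 * shiftedEnergy L ν (radialMeasure (eqDensity g) T) +
        ∫⁻ z, ENNReal.ofReal (g ‖z‖) ∂ν := by
  calc 2 * ENNReal.ofReal (L - Real.log T + g T / 2)
      = ∫⁻ _, 2 * ENNReal.ofReal (L - Real.log T + g T / 2) ∂ν := by simp
    _ ≤ ∫⁻ z, (2 * ∫⁻ w, shiftedKernel L z w ∂(radialMeasure (eqDensity g) T) +
          ENNReal.ofReal (g ‖z‖)) ∂ν := by
        refine lintegral_mono_ae ?_
        filter_upwards [hν, compl_mem_ae_iff.2 h0] with z hz hz0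
        exact hg.le_two_mul_lintegral_shiftedKernel_add hT hgT hz0 (by linarith)
    _ = _ := by
        rw [shiftedEnergy, ← lintegral_const_mul' _ _ (by simp),
          ← lintegral_add_right _ hg.measurable_norm.ennreal_ofReal]

lemma lintegral_norm_ne_top (hg : IsRadialProfile g) {R : ℝ} (hR : 0 ≤ R) {ν : Measure ℂ}
    [IsProbabilityMeasure ν] (hν : ∀ᵐ z ∂ν, ‖z‖ ≤ R) :
    ∫⁻ z, ENNReal.ofReal (g ‖z‖) ∂ν ≠ ⊤ := by
  refine ne_top_of_le_ne_top (b := ∫⁻ _, ENNReal.ofReal (g R) ∂ν) (by simp) ?_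
  refine lintegral_mono_ae (hν.mono fun z hz => ENNReal.ofReal_le_ofReal ?_)
  exact hg.monotoneOn (mem_Ici.2 (norm_nonneg z)) (mem_Ici.2 hR) hz

section Comparison

variable {T R : ℝ} {ν : Measure ℂ} [IsProbabilityMeasure ν]

lemma ae_norm_le_radialMeasure (hTR : T ≤ R) : ∀ᵐ z ∂(radialMeasure (eqDensity g) T), ‖z‖ ≤ R :=
  (ae_radialMeasure _ _).mono fun _ hz => hz.2.trans hTR

lemma shiftedEnergy_add_lintegral_le (hg : IsRadialProfile g) (hT : 0 < T)
    (hgT : T * deriv g T = 2) (hTR : T ≤ R) (hν : ∀ᵐ z ∂ν, ‖z‖ ≤ R) :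
    shiftedEnergy (Real.log (2 * R)) (radialMeasure (eqDensity g) T)
        (radialMeasure (eqDensity g) T) +
      ∫⁻ z, ENNReal.ofReal (g ‖z‖) ∂(radialMeasure (eqDensity g) T) ≤
    shiftedEnergy (Real.log (2 * R)) ν ν + ∫⁻ z, ENNReal.ofReal (g ‖z‖) ∂ν := by
  have := hg.isProbabilityMeasure hT hgT
  have hR : 0 < 2 * R := by linarith
  have hL : 2 * R ≤ Real.exp (Real.log (2 * R)) := (Real.exp_log hR).ge
  have hμ := ae_norm_le_radialMeasure (g := g) hTR
  by_cases hfin : shiftedEnergy (Real.log (2 * R)) ν ν = ⊤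
  · rw [hfin, top_add]
    exact le_top
  have h0 := measure_singleton_eq_zero hfin 0
  have hμ0 : radialMeasure (eqDensity g) T {0} = 0 :=
    compl_mem_ae_iff.1 ((ae_radialMeasure _ _).mono fun _ hz => hz.1)
  have h1 := hg.le_two_mul_shiftedEnergy_add hT hgT hTR hL hν h0
  rw [← hg.two_mul_shiftedEnergy_add hT hgT ((by linarith : 2 * T ≤ 2 * R).trans hL)] at h1
  have h2 := two_mul_shiftedEnergy_le hR (ae_ae_norm_sub_le hν hν) (ae_ae_norm_sub_le hμ hμ)
    (ae_ae_norm_sub_le hν hμ)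
  have h3 := ne_top_of_le_ne_top ENNReal.ofReal_ne_top (hg.shiftedEnergy_le hT hgT hTR hL hμ hμ0)
  have h4 := h1.trans (add_le_add_left h2 _)
  -- With `S` the shifted energy and `G` the field integral, `h4` reads `2 S(μ,μ) + G(μ) ≤ S(ν,ν) +
  -- S(μ,μ) + G(ν)`; one finite `S(μ,μ)` cancels.
  rw [two_mul (shiftedEnergy _ (radialMeasure _ _) _), add_assoc,
    add_comm (shiftedEnergy _ ν ν), add_assoc] at h4
  exact (ENNReal.add_le_add_iff_left h3).1 h4

lemma eq_of_shiftedEnergy_add_lintegral_le (hg : IsRadialProfile g) (hT : 0 < T)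
    (hgT : T * deriv g T = 2) (hTR : T ≤ R) (hν : ∀ᵐ z ∂ν, ‖z‖ ≤ R)
    (hle : shiftedEnergy (Real.log (2 * R)) ν ν + ∫⁻ z, ENNReal.ofReal (g ‖z‖) ∂ν ≤
      shiftedEnergy (Real.log (2 * R)) (radialMeasure (eqDensity g) T)
        (radialMeasure (eqDensity g) T) +
      ∫⁻ z, ENNReal.ofReal (g ‖z‖) ∂(radialMeasure (eqDensity g) T)) :
    ν = radialMeasure (eqDensity g) T := by
  have := hg.isProbabilityMeasure hT hgT
  have hR : 0 < 2 * R := by linarith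
  have hL : 2 * R ≤ Real.exp (Real.log (2 * R)) := (Real.exp_log hR).ge
  have hμ := ae_norm_le_radialMeasure (g := g) hTR
  have hμ0 : radialMeasure (eqDensity g) T {0} = 0 :=
    compl_mem_ae_iff.1 ((ae_radialMeasure _ _).mono fun _ hz => hz.1)
  have hμfin := ne_top_of_le_ne_top ENNReal.ofReal_ne_top
    (hg.shiftedEnergy_le hT hgT hTR hL hμ hμ0)
  have hR0 : 0 ≤ R := hT.le.trans hTR
  have hfin : shiftedEnergy (Real.log (2 * R)) ν ν ≠ ⊤ := fun h => by
    rw [h, top_add, top_le_iff] at hle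
    exact ENNReal.add_ne_top.2 ⟨hμfin, hg.lintegral_norm_ne_top hR0 hμ⟩ hle
  have h0 := measure_singleton_eq_zero hfin 0
  have h1 := hg.le_two_mul_shiftedEnergy_add hT hgT hTR hL hν h0
  rw [← hg.two_mul_shiftedEnergy_add hT hgT ((by linarith : 2 * T ≤ 2 * R).trans hL)] at h1
  refine eq_of_shiftedEnergy_le hR (ae_ae_norm_sub_le hν hν) (ae_ae_norm_sub_le hμ hμ)
    (ae_ae_norm_sub_le hν hμ) (ne_top_of_le_ne_top ENNReal.ofReal_ne_top
      (hg.shiftedEnergy_le hT hgT hTR hL hν h0)) ?_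
  -- After adding `G(ν)`, the chain is `S(ν,ν) + S(μ,μ) + G(ν) ≤ 2 S(μ,μ) + G(μ) ≤ 2 S(ν,μ) + G(ν)`.
  refine (ENNReal.add_le_add_iff_right (hg.lintegral_norm_ne_top hR0 hν)).1 (le_trans ?_ h1)
  rw [two_mul (shiftedEnergy _ (radialMeasure _ _) _), add_right_comm (shiftedEnergy _ ν ν),
    add_right_comm (shiftedEnergy _ (radialMeasure _ _) _)]
  exact add_le_add_left hle _

end Comparison

/-- The measure supported on the disk minimizes the weighted energy. -/
theorem weightedEnergy_le (hg : IsRadialProfile g) {T : ℝ} (hT : 0 < T)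
    (hgT : T * deriv g T = 2) {ν : Measure ℂ} (hν : ν ∈ compactProb univ) :
    weightedEnergy (radialField g) (radialMeasure (eqDensity g) T) ≤
      weightedEnergy (radialField g) ν := by
  have := hν.1
  have := hg.isProbabilityMeasure hT hgT
  obtain ⟨R₀, hR₀⟩ := exists_ae_norm_le hν
  -- A common radius for both measures; the `1` makes the shift `log (2R)` nonnegative.
  set R := max (max 1 T) R₀
  have hTR : T ≤ R := (le_max_right _ _).trans (le_max_left _ _)
  have h1R : 1 ≤ R := (le_max_left _ _).trans (le_max_left _ _)
  have hνR : ∀ᵐ z ∂ν, ‖z‖ ≤ R := hR₀.mono fun z hz => hz.trans (le_max_right _ _)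
  have hμR := ae_norm_le_radialMeasure (g := g) hTR
  rw [weightedEnergy_radialField hg (by linarith) (ae_ae_norm_sub_le hνR hνR),
    weightedEnergy_radialField hg (by linarith) (ae_ae_norm_sub_le hμR hμR)]
  exact EReal.sub_le_sub (EReal.coe_ennreal_le_coe_ennreal_iff.2
    (hg.shiftedEnergy_add_lintegral_le hT hgT hTR hνR)) le_rfl

/-- The minimizer of the weighted energy is unique. -/
theorem eq_of_weightedEnergy_le (hg : IsRadialProfile g) {T : ℝ} (hT : 0 < T)
    (hgT : T * deriv g T = 2) {ν : Measure ℂ} (hν : ν ∈ compactProb univ)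
    (hle : weightedEnergy (radialField g) ν ≤
      weightedEnergy (radialField g) (radialMeasure (eqDensity g) T)) :
    ν = radialMeasure (eqDensity g) T := by
  have := hν.1
  have := hg.isProbabilityMeasure hT hgT
  obtain ⟨R₀, hR₀⟩ := exists_ae_norm_le hν
  set R := max (max 1 T) R₀
  have hTR : T ≤ R := (le_max_right _ _).trans (le_max_left _ _)
  have h1R : 1 ≤ R := (le_max_left _ _).trans (le_max_left _ _)
  have hνR : ∀ᵐ z ∂ν, ‖z‖ ≤ R := hR₀.mono fun z hz => hz.trans (le_max_right _ _)
  have hμR := ae_norm_le_radialMeasure (g := g) hTR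
  rw [weightedEnergy_radialField hg (by linarith) (ae_ae_norm_sub_le hνR hνR),
    weightedEnergy_radialField hg (by linarith) (ae_ae_norm_sub_le hμR hμR)] at hle
  refine hg.eq_of_shiftedEnergy_add_lintegral_le hT hgT hTR hνR
    (EReal.coe_ennreal_le_coe_ennreal_iff.1 ?_)
  have := add_le_add_left hle (Real.log (2 * R) : EReal)
  rwa [EReal.sub_add_cancel, EReal.sub_add_cancel] at this

theorem weightedEnergy_eq (hg : IsRadialProfile g) {T : ℝ} (hT : 0 < T)
    (hgT : T * deriv g T = 2) :
    weightedEnergy (radialField g) (radialMeasure (eqDensity g) T) =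
      ((Real.log (1 / T) + g T - 1 / 4 * ∫ r in (0 : ℝ)..T, r * (deriv g r) ^ 2 : ℝ) : EReal) := by
  have := hg.isProbabilityMeasure hT hgT
  set D := max 1 (2 * T)
  have hD : 0 < D := zero_lt_one.trans_le (le_max_left _ _)
  have hμT := ae_norm_le_radialMeasure (g := g) (le_refl T)
  have hμD := (ae_ae_norm_sub_le hμT hμT).mono fun z hz => hz.mono fun w hw =>
    hw.trans (le_max_right 1 (2 * T))
  rw [weightedEnergy_radialField hg (le_max_left 1 (2 * T)) hμD]
  rw [hg.shiftedEnergy_add_lintegral hT hgT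
    ((le_max_right _ _).trans (Real.exp_log hD).ge), EReal.coe_ennreal_ofReal, max_eq_left,
    ← EReal.coe_sub]
  · congr 1
    rw [Real.log_div one_ne_zero hT.ne', Real.log_one]
    simp only [D]
    ring
  -- Integration by parts turns this into `∫ r g'² ≤ 2 g(T)`, which shows that the real number
  -- inside `ENNReal.ofReal` was not truncated.
  · have h1 : 0 ≤ ∫ r in (0 : ℝ)..T, massDeriv g r * g r := by
      rw [intervalIntegral.integral_of_le hT.le]
      exact setIntegral_nonneg measurableSet_Ioc fun r hr =>
        mul_nonneg (hg.massDeriv_nonneg hr.1) (hg.nonneg r hr.1.le)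
    rw [hg.integral_massDeriv_mul hT, hgT] at h1
    have h2 : Real.log T ≤ Real.log D :=
      Real.log_le_log hT ((by linarith : T ≤ 2 * T).trans (le_max_right _ _))
    linarith [hg.nonneg T hT.le]

/-! ### Admissibility, the equilibrium measure and the minimum energy. -/

lemma continuousAt_radialField (hg : IsRadialProfile g) {z : ℂ} (hz : z ≠ 0) :
    ContinuousAt (radialField g) z := by
  have h1 : ContinuousAt g ‖z‖ := (hg.hasDerivAt (norm_pos_iff.2 hz)).continuousAt
  exact (ContinuousAt.comp (f := fun z : ℂ => ‖z‖) h1 continuous_norm.continuousAt).div_const 2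

theorem isAdmissible (hg : IsRadialProfile g) {T : ℝ} (hT : 0 < T) (hgT : T * deriv g T = 2) :
    IsAdmissible univ (fun z => Real.exp (-radialField g z)) where
  isClosed := isClosed_univ
  nonneg _ _ := (Real.exp_pos _).le
  upperSemicontinuousOn := by
    rw [upperSemicontinuousOn_univ_iff]
    intro z
    rcases eq_or_ne z 0 with rfl | hz
    -- Continuity may fail at the origin, but the weight attains its maximum there because `g` is
    -- increasing.
    · intro y hy
      refine Eventually.of_forall fun w => lt_of_le_of_lt ?_ hy
      refine Real.exp_le_exp.2 (neg_le_neg ?_)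
      simp only [radialField, norm_zero]
      linarith [hg.monotoneOn (mem_Ici.2 le_rfl) (mem_Ici.2 (norm_nonneg w)) (norm_nonneg w)]
    · exact ((hg.continuousAt_radialField hz).neg.rexp).upperSemicontinuousAt
  capacity_pos := by
    have hmem := hg.radialMeasure_mem_compactProb hT hgT
    have := hmem.1
    have hμT := ae_norm_le_radialMeasure (g := g) (le_max_right 1 T)
    have hD : 1 ≤ 2 * max 1 T := by linarith [le_max_left 1 T]
    have hμ0 : radialMeasure (eqDensity g) T {0} = 0 :=
      compl_mem_ae_iff.1 ((ae_radialMeasure _ _).mono fun _ hz => hz.1)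
    -- The candidate itself witnesses positive capacity.
    have hfin : logEnergy (radialMeasure (eqDensity g) T) < ⊤ := by
      have h := ne_top_of_le_ne_top ENNReal.ofReal_ne_top (hg.shiftedEnergy_le hT hgT
        (le_max_right 1 T) (Real.exp_log (zero_lt_one.trans_le hD)).ge hμT hμ0)
      rw [logEnergy_eq_sub hD (ae_ae_norm_sub_le hμT hμT), ← ENNReal.coe_toNNReal h,
        EReal.coe_nnreal_eq_coe_real, ← EReal.coe_sub]
      exact EReal.coe_lt_top _
    have hset : {z : ℂ | z ∈ univ ∧ 0 < Real.exp (-radialField g z)} = univ :=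
      eq_univ_of_forall fun z => ⟨mem_univ z, Real.exp_pos _⟩
    rw [capacity, hset, EReal.zero_lt_exp_iff, EReal.lt_neg_comm, EReal.neg_bot]
    exact (iInf₂_le _ hmem).trans_lt hfin
  decay := by
    rw [principal_univ, inf_top_eq]
    exact hg.decay.comp tendsto_norm_cobounded_atTop

theorem isEquilibriumMeasure_iff (hg : IsRadialProfile g) {T : ℝ} (hT : 0 < T)
    (hgT : T * deriv g T = 2) (μ : Measure ℂ) :
    IsEquilibriumMeasure univ (radialField g) μ ↔ μ = radialMeasure (eqDensity g) T := by
  have hmem := hg.radialMeasure_mem_compactProb hT hgT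
  constructor
  · exact fun h => hg.eq_of_weightedEnergy_le hT hgT h.mem (h.minimizes _ hmem)
  · rintro rfl
    exact ⟨hg.isAdmissible hT hgT, hmem, fun ν hν => hg.weightedEnergy_le hT hgT hν⟩

theorem minEnergy_eq (hg : IsRadialProfile g) {T : ℝ} (hT : 0 < T) (hgT : T * deriv g T = 2) :
    minEnergy (radialField g) ∅ =
      ((Real.log (1 / T) + g T - 1 / 4 * ∫ r in (0 : ℝ)..T, r * (deriv g r) ^ 2 : ℝ) : EReal) := by
  rw [← hg.weightedEnergy_eq hT hgT, minEnergy, compl_empty]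
  exact le_antisymm (iInf₂_le _ (hg.radialMeasure_mem_compactProb hT hgT))
    (le_iInf₂ fun ν hν => hg.weightedEnergy_le hT hgT hν)

/-! ### Existence and uniqueness of the radius. -/

/-- If `r g'(r)` stayed below `2`, then `g - 2 log r` would decrease on `[1, ∞)`, and `r exp(-g/2)`
would stay bounded away from `0`. So `r g'(r)` reaches `2`, and the intermediate value theorem
applies from its value `0` at the origin. -/
lemma exists_mul_deriv_eq (hg : IsRadialProfile g) : ∃ T : ℝ, 0 < T ∧ T * deriv g T = 2 := by
  have hex : ∃ b : ℝ, 0 < b ∧ 2 ≤ b * deriv g b := by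
    by_contra! hlt
    have hanti {r : ℝ} (hr : 1 ≤ r) : g r - 2 * Real.log r ≤ g 1 := by
      have hd {r : ℝ} (hr : 1 ≤ r) : HasDerivAt (fun r => g r - 2 * Real.log r)
          (deriv g r - 2 * r⁻¹) r :=
        (hg.hasDerivAt (zero_lt_one.trans_le hr)).sub
          ((Real.hasDerivAt_log (zero_lt_one.trans_le hr).ne').const_mul 2)
      have := antitoneOn_of_deriv_nonpos (convex_Ici (1 : ℝ))
        (fun r hr => (hd hr).continuousAt.continuousWithinAt)
        (fun r hr => (hd (interior_subset hr)).differentiableAt.differentiableWithinAt)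
        (fun r hr => ?_) (mem_Ici.2 le_rfl) (mem_Ici.2 hr) hr
      · simpa using this
      · have hr : 1 ≤ r := interior_subset hr
        have h0 : 0 < r := zero_lt_one.trans_le hr
        rw [(hd hr).deriv, sub_nonpos, ← div_eq_mul_inv, le_div_iff₀ h0]
        linarith [hlt r h0]
    have hlb : ∀ᶠ r : ℝ in atTop, Real.exp (-(g 1 / 2)) ≤ r * Real.exp (-(g r / 2)) := by
      filter_upwards [eventually_ge_atTop 1] with r hr
      have h0 : 0 < r := zero_lt_one.trans_le hr
      rw [← Real.exp_log h0, ← Real.exp_add, Real.exp_log h0]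
      refine Real.exp_le_exp.2 ?_
      linarith [hanti hr]
    exact (Real.exp_pos _).not_ge (ge_of_tendsto hg.decay hlb)
  obtain ⟨b, hb, h2⟩ := hex
  obtain ⟨T, hT, h⟩ := intermediate_value_Icc hb.le
    (hg.continuousOn_mul_deriv.mono Icc_subset_Ici_self) (show (2 : ℝ) ∈ Icc _ _ by simpa using h2)
  refine ⟨T, hT.1.lt_of_ne ?_, h⟩
  rintro rfl
  simp at h

lemma existsUnique_mul_deriv_eq (hg : IsRadialProfile g)
    (hmono : StrictMonoOn (fun r => r * deriv g r) (Ioi 0)) :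
    ∃! T : ℝ, 0 < T ∧ T * deriv g T = 2 := by
  obtain ⟨T, hT, h⟩ := hg.exists_mul_deriv_eq
  exact ⟨T, ⟨hT, h⟩, fun S hS => hmono.injOn hS.1 hT (hS.2.trans h.symm)⟩

end IsRadialProfile

/-! ### Power profiles. -/

lemma deriv_rpow_const_of_pos (α : ℝ) {r : ℝ} (hr : 0 < r) :
    deriv (fun r : ℝ => r ^ α) r = α * r ^ (α - 1) :=
  (Real.hasDerivAt_rpow_const (Or.inl hr.ne')).deriv

lemma mul_deriv_rpow (α : ℝ) {r : ℝ} (hr : 0 < r) :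
    r * deriv (fun r : ℝ => r ^ α) r = α * r ^ α := by
  rw [deriv_rpow_const_of_pos α hr, Real.rpow_sub_one hr.ne']
  field_simp

lemma hasDerivAt_deriv_rpow (α : ℝ) {r : ℝ} (hr : 0 < r) :
    HasDerivAt (deriv fun r : ℝ => r ^ α) (α * ((α - 1) * r ^ (α - 1 - 1))) r := by
  refine ((Real.hasDerivAt_rpow_const (Or.inl hr.ne')).const_mul α).congr_of_eventuallyEq ?_
  filter_upwards [Ioi_mem_nhds hr] with x hx using deriv_rpow_const_of_pos α hx

lemma isRadialProfile_rpow {α : ℝ} (hα : 0 < α) : IsRadialProfile (fun r : ℝ => r ^ α) where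
  nonneg _ hr := Real.rpow_nonneg hr _
  monotoneOn := fun _ ha _ _ hab => Real.rpow_le_rpow ha hab hα.le
  decay := by
    -- Substituting `s = r^α` turns the expression into `s^(1/α) exp(-s/2)`.
    have h := (tendsto_rpow_mul_exp_neg_mul_atTop_nhds_zero (1 / α) (1 / 2) (by norm_num)).comp
      (tendsto_rpow_atTop hα)
    refine h.congr' ?_
    filter_upwards [eventually_ge_atTop 0] with r hr
    simp only [Function.comp_apply]
    rw [← Real.rpow_mul hr, mul_one_div_cancel hα.ne', Real.rpow_one]
    ring_nf
  differentiableAt r hr := (Real.hasDerivAt_rpow_const (Or.inl hr.ne')).differentiableAt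
  differentiableAt_deriv r hr := (hasDerivAt_deriv_rpow α hr).differentiableAt
  tendsto_zero := by
    have h : Tendsto (fun r : ℝ => α * r ^ α) (𝓝[>] 0) (𝓝 (α * 0 ^ α)) :=
      ((Real.continuousAt_rpow_const 0 α (Or.inr hα.le)).tendsto.const_mul α).mono_left
        nhdsWithin_le_nhds
    rw [Real.zero_rpow hα.ne', mul_zero] at h
    refine h.congr' ?_
    filter_upwards [self_mem_nhdsWithin] with r hr using (mul_deriv_rpow α hr).symm
  monotoneOn_mul_deriv := by
    intro a ha b hb hab
    dsimp only
    rw [mul_deriv_rpow α ha, mul_deriv_rpow α hb]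
    exact mul_le_mul_of_nonneg_left (Real.rpow_le_rpow (le_of_lt ha) hab hα.le) hα.le

lemma mul_deriv_rpow_eq_two_iff {α T : ℝ} (hα : 0 < α) (hT : 0 < T) :
    T * deriv (fun r : ℝ => r ^ α) T = 2 ↔ T = (2 / α) ^ (1 / α) := by
  rw [mul_deriv_rpow α hT, mul_comm, ← eq_div_iff hα.ne', one_div,
    Real.eq_rpow_inv hT.le (by positivity) hα.ne']

/-- Only positive radii matter, since the origin is Lebesgue-null; the simplified power density need
not be correct at `r = 0`. -/
lemma radialMeasure_congr {ρ ρ' : ℝ → ℝ} (h : ∀ r, 0 < r → ρ r = ρ' r) (T : ℝ) :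
    radialMeasure ρ T = radialMeasure ρ' T := by
  refine withDensity_congr_ae (ae_restrict_of_ae ?_)
  filter_upwards [Measure.ae_ne volume (0 : ℂ)] with z hz
  rw [h _ (norm_pos_iff.2 hz)]

lemma eqDensity_rpow (α : ℝ) {r : ℝ} (hr : 0 < r) :
    eqDensity (fun r : ℝ => r ^ α) r = α ^ 2 / (4 * Real.pi) * r ^ (α - 2) := by
  have := Real.pi_pos
  rw [eqDensity, (hasDerivAt_deriv_rpow α hr).deriv, deriv_rpow_const_of_pos α hr,
    show α - 2 = α - 1 - 1 by ring, Real.rpow_sub_one hr.ne' (α - 1)]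
  field_simp
  ring

lemma integral_mul_deriv_rpow_sq {α T : ℝ} (hα : 0 < α) (hT : 0 < T) :
    ∫ r in (0 : ℝ)..T, r * deriv (fun r : ℝ => r ^ α) r ^ 2 = α / 2 * (T ^ α) ^ 2 := by
  have h : ∫ r in (0 : ℝ)..T, r * deriv (fun r : ℝ => r ^ α) r ^ 2 =
      ∫ r in (0 : ℝ)..T, α ^ 2 * r ^ (2 * α - 1) := by
    refine intervalIntegral.integral_congr_ae (ae_of_all _ fun r hr => ?_)
    rw [uIoc_of_le hT.le] at hr
    have hadd : r * r ^ ((α - 1) * 2) = r ^ (2 * α - 1) := by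
      rw [show 2 * α - 1 = 1 + (α - 1) * 2 by ring, Real.rpow_add hr.1, Real.rpow_one]
    rw [deriv_rpow_const_of_pos α hr.1, mul_pow, ← Real.rpow_mul_natCast hr.1.le, mul_left_comm]
    norm_num [hadd]
  rw [h, intervalIntegral.integral_const_mul, integral_rpow (Or.inl (by linarith)),
    sub_add_cancel, Real.zero_rpow (by positivity), mul_comm 2 α, Real.rpow_mul hT.le]
  norm_num
  field_simp

end

end LogPotential

theorem mainTheorem6 :
    (∀ g : ℝ → ℝ, LogPotential.IsRadialProfile g →
      (∃ T : ℝ, 0 < T ∧ T * deriv g T = 2) ∧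
      (StrictMonoOn (fun r : ℝ => r * deriv g r) (Set.Ioi 0) →
        ∃! T : ℝ, 0 < T ∧ T * deriv g T = 2) ∧
      (∀ r : ℝ, 0 < r → 0 ≤ LogPotential.eqDensity g r) ∧
      ∀ T : ℝ, 0 < T → T * deriv g T = 2 →
        (∀ μ : MeasureTheory.Measure ℂ,
          LogPotential.IsEquilibriumMeasure Set.univ (LogPotential.radialField g) μ ↔
            μ = LogPotential.radialMeasure (LogPotential.eqDensity g) T) ∧
        IntervalIntegrable (fun r : ℝ => r * (deriv g r) ^ 2) MeasureTheory.volume 0 T ∧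
        LogPotential.minEnergy (LogPotential.radialField g) ∅ =
          ((Real.log (1 / T) + g T - 1 / 4 * ∫ r in (0 : ℝ)..T, r * (deriv g r) ^ 2 : ℝ) :
            EReal)) ∧
    (∀ α : ℝ, 0 < α →
      LogPotential.IsRadialProfile (fun r : ℝ => r ^ α) ∧
      (∀ T : ℝ, 0 < T →
        (T * deriv (fun r : ℝ => r ^ α) T = 2 ↔ T = (2 / α) ^ (1 / α))) ∧
      (∀ μ : MeasureTheory.Measure ℂ,
        LogPotential.IsEquilibriumMeasure Set.univ
            (LogPotential.radialField (fun r : ℝ => r ^ α)) μ ↔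
          μ = LogPotential.radialMeasure
            (fun r : ℝ => α ^ 2 / (4 * Real.pi) * r ^ (α - 2)) ((2 / α) ^ (1 / α))) ∧
      LogPotential.minEnergy (LogPotential.radialField (fun r : ℝ => r ^ α)) ∅ =
        ((3 / 4 * (2 / α) - 1 / α * Real.log (2 / α) : ℝ) : EReal)) := by
  refine ⟨fun g hg => ⟨hg.exists_mul_deriv_eq, hg.existsUnique_mul_deriv_eq,
    fun r hr => hg.eqDensity_nonneg hr, fun T hT hgT => ⟨hg.isEquilibriumMeasure_iff hT hgT,
    hg.intervalIntegrable_mul_deriv_sq hT, hg.minEnergy_eq hT hgT⟩⟩, fun α hα => ?_⟩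
  have hg := LogPotential.isRadialProfile_rpow hα
  have hT : 0 < (2 / α) ^ (1 / α) := by positivity
  have hgT := (LogPotential.mul_deriv_rpow_eq_two_iff hα hT).2 rfl
  refine ⟨hg, fun T hT => LogPotential.mul_deriv_rpow_eq_two_iff hα hT, fun μ => ?_, ?_⟩
  · rw [hg.isEquilibriumMeasure_iff hT hgT,
      LogPotential.radialMeasure_congr fun r hr => LogPotential.eqDensity_rpow α hr]
  · have hTα : ((2 / α) ^ (1 / α)) ^ α = 2 / α := by
      rw [← Real.rpow_mul (by positivity), one_div_mul_cancel hα.ne', Real.rpow_one]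
    rw [hg.minEnergy_eq hT hgT, LogPotential.integral_mul_deriv_rpow_sq hα hT, hTα, one_div,
      Real.log_inv, Real.log_rpow (by positivity)]
    congr 1
    field_simp
    ring
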